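/- **Model.** There are $n\ge 1$ participants $P_1,\dots,P_n$; put $t=\lfloor (n-1)/3\rfloor$. A static adversary corrupts a fixed set of at most $t$ of them; the others are honest. Messages are exchanged by an (ideal, authenticated) reliable broadcast primitive: for every participant, step and kind of message at most one message is ever broadcast, every participant that receives it receives the same one, and only $P_i$ can broadcast in the name of $P_i$. The network is completely asynchronous. The adversary, which is computationally unbounded and knows the whole history of the execution (all local states and all coin outcomes used so far, but not future coins), decides at every time whether to broadcast an arbitrary message of a corrupted participant, to deliver a broadcast message to some participant, or to let some honest participant run. An execution is *fair* if every broadcast message is eventually delivered to every honest participant and every honest participant runs infinitely often. **Messages.** A message $\langle P_j,v,\mathcal M\rangle$ consists of a sender, a value $v\in\{0,1,\perp\}$ and a message set $\mathcal M$ (its justification); it belongs to one of the sub-steps $1,2,3$ of a step $s=0,1,2,\dots$, or is the decision message of a step $s$. A decision message of step $s$ also counts as its sender's message, with the decided value, in all sub-steps of all steps after $s$. A participant equivocates within $\mathcal M$ if $\mathcal M$ contains two different messages from it; let $I(\mathcal M)$ be the set of these participants. For $b\in\{0,1\}$ let $\mathrm{score}(b,\mathcal M)$ be the number of participants outside $I(\mathcal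 M)$ that have a message with value $b$ in $\mathcal M$. A message is *valid* for $P_i$ if it and, recursively, all messages in its justification were delivered to $P_i$ and each of them has a value that its sender could have obtained from its justification by following the protocol below (a value obtained from a coin may be any bit). Messages that are not valid are excluded; $\mathcal M_{i,s,k}$ denotes the set of the valid messages for sub-step $k$ of step $s$ that $P_i$ has when it finishes waiting, and "$P_i$ waits" means that it waits until these come from at least $n-t+|I(\mathcal M_{i,s,k})|$ participants. **Protocol.** Honest $P_i$ starts with an input $x_i\in\{0,1\}$ and, in step $s=0,1,2,\dots$, does the following. 1. It broadcasts $\langle P_i,x_i,\mathcal M_{i,s-1,3}\rangle$ (with $\mathcal M_{i,-1,3}=\emptyset$), waits, and lets $e_{i,s}$ be the bit with the larger score in $\mathcal M_{i,s,1}$, or a coin flip in case of a tie. 2. It broadcasts $\langle P_i,e_{i,s},\mathcal M_{i,s,1}\rangle$, waits, and lets $e'_{i,s}=b$ if $\mathrm{score}(b,\mathcal M_{i,s,2})>n/2$ for some $b\in\{0,1\}$, and $e'_{i,s}=\perp$ otherwise. 3. It broadcasts $\langle P_i,e'_{i,s},\mathcal M_{i,s,2}\rangle$ and waits. If $\mathrm{score}(b,\mathcal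 M_{i,s,3})\ge 2t+1$ for some $b\in\{0,1\}$, then it decides $b$, broadcasts the decision message $\langle P_i,b,\mathcal M_{i,s,3}\rangle$ and stops. Otherwise it sets $x_i=b$ if $\mathrm{score}(b,\mathcal M_{i,s,3})\ge t+1$ for some $b\in\{0,1\}$, sets $x_i$ to a coin flip if there is no such $b$, and moves to step $s+1$. All coin flips are fair and independent. With *local coins*, every participant has its own coin for each of the two flips of each step; with a *common coin*, all participants see the same coin for each of the two flips of each step. **Theorem.** The protocol is a probabilistic Byzantine agreement protocol in complete asynchronous networks that tolerates $t=\lfloor (n-1)/3\rfloor$ Byzantine participants. That is, there is an absolute constant $C$ such that for every $n\ge1$, every set of at most $t$ corrupted participants, all inputs and every adversary: * (Safety) For all coin outcomes, two honest participants never decide on different values; and in every fair execution, if one honest participant decides on $b$, then every honest participant decides on $b$. * (Validity) For all coin outcomes, if all honest participants have the same input $b$, then every honest participant that decides, decides on $b$. * (Liveness, local coins) If executions with local coins are fair almost surely, then with probability $1$ all honest participants decide, and the expected number of steps until all of them have decided is at most $C\cdot 2^n$. * (Liveness, common coin) If executions with a common coin are fair almost surely, then with probability $1$ all honest participants decide,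 and the expected number of steps until all of them have decided is at most $C$. -/

import Mathlib

open MeasureTheory
open scoped ENNReal NNReal

namespace CasperBFT

/-- The three sub-steps of a protocol step. -/
inductive Substep
  | first
  | second
  | third

/-- A message is the vote of some sub-step or a decision message. -/
inductive Kind
  | vote (k : Substep)
  | decision

/-- The message `⟨P_sender, value, just⟩` of protocol step `step`.
`value = none` stands for `⊥`; `just` is the message set that justifies the value. -/
structure Msg (n : ℕ) : Type where
  sender : Fin n
  step : ℕ
  kind : Kind
  value : Option Bool
  just : List (Msg n)

section MessageSets

variable {n : ℕ}

open scoped Classical in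
/-- The participants from which the message set `M` contains a message. -/
noncomputable def senders (M : List (Msg n)) : Finset (Fin n) :=
  Finset.univ.filter fun j => ∃ m ∈ M, m.sender = j

open scoped Classical in
/-- The participants that equivocate within `M`: a message set of one sub-step has at most one
message of each participant that follows the protocol. -/
noncomputable def equivocators (M : List (Msg n)) : Finset (Fin n) :=
  Finset.univ.filter fun j =>
    ∃ m₁ ∈ M, ∃ m₂ ∈ M, m₁.sender = j ∧ m₂.sender = j ∧ m₁ ≠ m₂

open scoped Classical in
/-- `score b M`: the number of participants voting `b` in `M`, equivocators excluded. -/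
noncomputable def score (b : Bool) (M : List (Msg n)) : ℕ :=
  (Finset.univ.filter fun j =>
    j ∉ equivocators M ∧ ∃ m ∈ M, m.sender = j ∧ m.value = some b).card

/-- `m` counts as a message of sub-step `k` of step `s`: it is a vote of that sub-step, or the
decision message of a participant that decided (and stopped) in an earlier step. -/
def CountsFor (s : ℕ) (k : Substep) (m : Msg n) : Prop :=
  (m.step = s ∧ m.kind = Kind.vote k) ∨ (m.kind = Kind.decision ∧ m.step < s)

/-- The message set `M` suffices to finish waiting in sub-step `k` of step `s`:
it has messages from at least `n - t + |I(M)|` participants. -/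
def IsQuorum (t s : ℕ) (k : Substep) (M : List (Msg n)) : Prop :=
  (∀ m ∈ M, CountsFor s k m) ∧ n - t + (equivocators M).card ≤ (senders M).card

/-- The content of `m` is what the protocol prescribes, given its justification `m.just`.
A value that the protocol takes from a coin may be any bit. -/
def Follows (t : ℕ) (m : Msg n) : Prop :=
  match m.kind with
  | Kind.vote Substep.first =>
      ∃ b, m.value = some b ∧
        ((m.step = 0 ∧ m.just = []) ∨
          ∃ s, m.step = s + 1 ∧ IsQuorum t s Substep.third m.just ∧
            (∀ c, score c m.just < 2 * t + 1) ∧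
            (t + 1 ≤ score b m.just ∨ ∀ c, score c m.just < t + 1))
  | Kind.vote Substep.second =>
      ∃ b, m.value = some b ∧ IsQuorum t m.step Substep.first m.just ∧
        score (!b) m.just ≤ score b m.just
  | Kind.vote Substep.third =>
      IsQuorum t m.step Substep.second m.just ∧
        ∀ b, m.value = some b ↔ n < 2 * score b m.just
  | Kind.decision =>
      ∃ b, m.value = some b ∧ IsQuorum t m.step Substep.third m.just ∧
        2 * t + 1 ≤ score b m.just

/-- `m` is a valid message for a participant to which the messages in `V` were delivered by
reliable broadcast: `m` and, recursively, all messages it depends on were delivered, and all of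
them follow the protocol. -/
inductive Valid (t : ℕ) (V : List (Msg n)) : Msg n → Prop
  | intro (m : Msg n) (delivered : m ∈ V) (follows : Follows t m)
      (just : ∀ m₁ ∈ m.just, Valid t V m₁) : Valid t V m

open scoped Classical in
/-- The message set of sub-step `k` of step `s` of a participant to which the messages in `V`
were delivered; messages that do not follow the protocol are excluded. -/
noncomputable def messageSet (t : ℕ) (V : List (Msg n)) (s : ℕ) (k : Substep) : List (Msg n) :=
  V.filter fun m => decide (Valid t V m ∧ CountsFor s k m)

/-- The value estimation function; `coin` is used in case of a tie. -/
noncomputable def estimate (M : List (Msg n)) (coin : Bool) : Bool :=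
  if score true M < score false M then false
  else if score false M < score true M then true
  else coin

open scoped Classical in
/-- A bit with the property `p`, if there is one. -/
noncomputable def pick (p : Bool → Prop) : Option Bool :=
  if p false then some false else if p true then some true else none

end MessageSets

/-- The two places of a step at which a coin may be flipped: a tie in the value estimation, and
the choice of `x_i` at the end of the step. -/
inductive Flip
  | tie
  | final

/-- The state of an honest participant: waiting for the messages of sub-step `k` of step `s`
(its own message of that sub-step has been broadcast), or stopped after deciding `b` at the end
of step `s`. -/
inductive LocalState
  | waiting (s : ℕ) (k : Substep)
  | decided (s : ℕ) (b : Bool)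

/-- What the honest participant `i` does when it has finished waiting in sub-step `k` of step `s`
with the message set `M`: its new state and the message it reliably broadcasts. -/
noncomputable def finishSubstep {n : ℕ} (t : ℕ) (coin : ℕ → Flip → Fin n → Bool) (i : Fin n)
    (s : ℕ) (k : Substep) (M : List (Msg n)) : LocalState × Msg n :=
  match k with
  | Substep.first =>
      (LocalState.waiting s Substep.second,
        ⟨i, s, Kind.vote Substep.second, some (estimate M (coin s Flip.tie i)), M⟩)
  | Substep.second =>
      (LocalState.waiting s Substep.third,
        ⟨i, s, Kind.vote Substep.third, pick (fun b => n < 2 * score b M), M⟩)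
  | Substep.third =>
      match pick (fun b => 2 * t + 1 ≤ score b M) with
      | some b => (LocalState.decided s b, ⟨i, s, Kind.decision, some b, M⟩)
      | none =>
          (LocalState.waiting (s + 1) Substep.first,
            ⟨i, s + 1, Kind.vote Substep.first,
              some ((pick (fun b => t + 1 ≤ score b M)).getD (coin s Flip.final i)), M⟩)

/-- A global configuration: the states of the participants, the messages that were reliably
broadcast so far, and the messages that reliable broadcast has delivered to each participant. -/
structure Config (n : ℕ) : Type where
  state : Fin n → LocalState
  sent : List (Msg n)
  received : Fin n → List (Msg n)

/-- The actions of the adversary, who controls the corrupted participants and the network: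
reliably broadcast a message of a corrupted participant, deliver a message, or let a participant
run. -/
inductive Action (n : ℕ) : Type
  | broadcast (m : Msg n)
  | deliver (i : Fin n) (m : Msg n)
  | activate (i : Fin n)

/-- An adversary chooses the next action from the complete history (latest configuration first),
including all states and all coin outcomes used so far. -/
abbrev Adversary (n : ℕ) : Type := List (Config n) → Action n

section Execution

variable {n : ℕ} (t : ℕ) (corrupt : Finset (Fin n))

/-- At the start every honest participant `i` reliably broadcasts `⟨P_i, x_i, ∅⟩`. -/
def startConfig (input : Fin n → Bool) : Config n where
  state := fun _ => LocalState.waiting 0 Substep.first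
  sent := ((List.finRange n).filter fun i => decide (i ∉ corrupt)).map fun i =>
    ⟨i, 0, Kind.vote Substep.first, some (input i), []⟩
  received := fun _ => []

open scoped Classical in
/-- The effect of an action. Reliable broadcast carries at most one message of each sender for
each step and kind of message, the same for all receivers, and nobody can broadcast in the name
of an honest participant. Actions that are not possible have no effect. -/
noncomputable def applyAction (coin : ℕ → Flip → Fin n → Bool) (c : Config n) :
    Action n → Config n
  | Action.broadcast m =>
      if m.sender ∈ corrupt ∧
          ∀ m₁ ∈ c.sent, ¬ (m₁.sender = m.sender ∧ m₁.step = m.step ∧ m₁.kind = m.kind) then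
        { c with sent := m :: c.sent }
      else c
  | Action.deliver i m =>
      if m ∈ c.sent ∧ m ∉ c.received i then
        { c with received := Function.update c.received i (m :: c.received i) }
      else c
  | Action.activate i =>
      if i ∈ corrupt then c
      else
        match c.state i with
        | LocalState.decided _ _ => c
        | LocalState.waiting s k =>
            if IsQuorum t s k (messageSet t (c.received i) s k) then
              { c with
                state := Function.update c.state i
                  (finishSubstep t coin i s k (messageSet t (c.received i) s k)).1
                sent := (finishSubstep t coin i s k (messageSet t (c.received i) s k)).2 :: c.sent }
            else c

/-- The configurations reached up to time `k`, latest first, when the coin of participant `i` at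
the place `f` of step `s` shows `coin s f i`. -/
noncomputable def trace (input : Fin n → Bool) (adv : Adversary n)
    (coin : ℕ → Flip → Fin n → Bool) : ℕ → Config n × List (Config n)
  | 0 => (startConfig corrupt input, [])
  | k + 1 =>
      let p := trace input adv coin k
      (applyAction t corrupt coin p.1 (adv (p.1 :: p.2)), p.1 :: p.2)

/-- The configuration at time `k`. -/
noncomputable def config (input : Fin n → Bool) (adv : Adversary n)
    (coin : ℕ → Flip → Fin n → Bool) (k : ℕ) : Config n :=
  (trace t corrupt input adv coin k).1

/-- The action that the adversary takes at time `k`. -/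
noncomputable def action (input : Fin n → Bool) (adv : Adversary n)
    (coin : ℕ → Flip → Fin n → Bool) (k : ℕ) : Action n :=
  adv ((trace t corrupt input adv coin k).1 :: (trace t corrupt input adv coin k).2)

/-- The only restriction on the asynchronous network: every reliably broadcast message is
eventually delivered to every honest participant, and every honest participant runs infinitely
often. -/
def Fair (input : Fin n → Bool) (adv : Adversary n) (coin : ℕ → Flip → Fin n → Bool) : Prop :=
  ∀ i, i ∉ corrupt →
    (∀ k, ∀ m ∈ (config t corrupt input adv coin k).sent,
      ∃ k₁, m ∈ (config t corrupt input adv coin k₁).received i) ∧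
    (∀ k, ∃ k₁, k ≤ k₁ ∧ action t corrupt input adv coin k₁ = Action.activate i)

/-- Participant `i` decides `b` at the end of step `s`. -/
def DecidesAt (input : Fin n → Bool) (adv : Adversary n) (coin : ℕ → Flip → Fin n → Bool)
    (i : Fin n) (s : ℕ) (b : Bool) : Prop :=
  ∃ k, (config t corrupt input adv coin k).state i = LocalState.decided s b

/-- Participant `i` decides `b`. -/
def Decides (input : Fin n → Bool) (adv : Adversary n) (coin : ℕ → Flip → Fin n → Bool)
    (i : Fin n) (b : Bool) : Prop :=
  ∃ s, DecidesAt t corrupt input adv coin i s b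

/-- The number of protocol steps (numbered from `0`) until all honest participants have decided;
`∞` if some of them never decides. -/
noncomputable def stepsToDecide (input : Fin n → Bool) (adv : Adversary n)
    (coin : ℕ → Flip → Fin n → Bool) : ℝ≥0∞ :=
  ⨅ S : {S : ℕ // ∀ i, i ∉ corrupt →
    ∃ s b, s ≤ S ∧ DecidesAt t corrupt input adv coin i s b}, ((S.1 : ℝ≥0∞) + 1)

end Execution

/-- Independent fair coins, one for each index. -/
noncomputable def fairCoins (ι : Type) : Measure (ι → Bool) :=
  Measure.infinitePi fun _ : ι => (PMF.uniformOfFintype Bool).toMeasure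

/-- Local coins: every participant has its own coin for every step and place. -/
def localCoin {n : ℕ} (ω : ℕ × Flip × Fin n → Bool) : ℕ → Flip → Fin n → Bool :=
  fun s f i => ω (s, f, i)

/-- A common coin: all participants see the same coin for every step and place. -/
def commonCoin {n : ℕ} (ω : ℕ × Flip → Bool) : ℕ → Flip → Fin n → Bool :=
  fun s f _ => ω (s, f)

end CasperBFT

open CasperBFT

/-!
Reliable broadcast leaves at most one message for each sender, step and kind. Participants can
equivocate within a message set only with a decision message, and this is harmless: once a
decision exists, only its value can appear in later steps. Hence agreement does not need honesty.
It is proved for any set of messages that has only members that follow the protocol, contains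
their justifications and satisfies this uniqueness (`Justified`).

*Agreement.* In a step without earlier decisions two majorities intersect, so the third votes of the
step have only one value besides `⊥`. The earliest decision, for `b` say, is based on `2t + 1` third
votes for `b`, and every other quorum contains `t + 1` of them; so all first votes of the next step
are for `b` (`Justified.locked_of_decision`). If all messages that count for the second sub-step of a
step have value `b` (`Locked`), then every third-sub-step quorum of this step forces the decision
`b`, later messages have value `b` as well, and no vote of the next step is justified
(`Locked.succ`, `Locked.no_first`). Unanimous honest first votes lead to this situation, since
at most `t` votes differ (`Locked.of_honest_first`); with the inputs this is validity.

*Progress.* Honest participants do not equivocate, and an equivocator is one more sender. So the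
messages of the honest participants suffice to finish waiting, and in a fair execution every honest
participant decides or passes all sub-steps (`eventually_position_ge`).

*Liveness.* Consider the quorum `M` of third votes with which the first participant leaves step `s`,
at a time when no coin of the end of step `s` has been read. If a value occurs in `M`, then the other
value is not available to anyone; a value that does not occur in `M` gets at most `t` votes in any
other quorum. So there is a bit, `favoured`, that is determined before these coins are flipped and
such that every honest participant either adopts it or flips a coin
(`Justified.locked_of_coin`). If all the coins show this bit, then it is locked in step `s + 1`,
and all honest participants decide by the end of that step (`decidesAt_of_coin_eq_favoured`). As the
coins are independent of the past (`trace_congr`), this happens in every step with conditional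
probability at least `2⁻ⁿ` for local coins and `1/2` for a common coin, and the expected number of
steps is at most `1 + 2ⁿ` or `3` by a geometric series (`lintegral_le_of_guess`).
-/

namespace CasperBFT

/-! ### Counting votes in message sets -/

section Counting

variable {n : ℕ} {t s : ℕ} {k : Substep} {b : Bool} {M M' : List (Msg n)}

theorem mem_senders {j : Fin n} : j ∈ senders M ↔ ∃ m ∈ M, m.sender = j := by
  simp [senders]

theorem mem_equivocators {j : Fin n} :
    j ∈ equivocators M ↔ ∃ m₁ ∈ M, ∃ m₂ ∈ M, m₁.sender = j ∧ m₂.sender = j ∧ m₁ ≠ m₂ := by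
  simp [equivocators]

open scoped Classical in
/-- The participants counted by `score b M`. -/
noncomputable def voters (b : Bool) (M : List (Msg n)) : Finset (Fin n) :=
  Finset.univ.filter fun j =>
    j ∉ equivocators M ∧ ∃ m ∈ M, m.sender = j ∧ m.value = some b

theorem card_voters : (voters b M).card = score b M := rfl

theorem mem_voters {j : Fin n} :
    j ∈ voters b M ↔ j ∉ equivocators M ∧ ∃ m ∈ M, m.sender = j ∧ m.value = some b := by
  simp [voters]

theorem equivocators_subset_senders : equivocators M ⊆ senders M := by
  intro j hj
  obtain ⟨m, hm, -, -, h, -⟩ := mem_equivocators.1 hj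
  exact mem_senders.2 ⟨m, hm, h⟩

theorem eq_of_notMem_equivocators {m₁ m₂ : Msg n} (h₁ : m₁ ∈ M) (h₂ : m₂ ∈ M)
    (h : m₁.sender = m₂.sender) (hj : m₂.sender ∉ equivocators M) : m₁ = m₂ := by
  by_contra hne
  exact hj (mem_equivocators.2 ⟨m₁, h₁, m₂, h₂, h, rfl, hne⟩)

theorem disjoint_voters : Disjoint (voters b M) (voters (!b) M) := by
  rw [Finset.disjoint_left]
  intro j h₁ h₂
  obtain ⟨hj, m₁, hm₁, rfl, hv₁⟩ := mem_voters.1 h₁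
  obtain ⟨-, m₂, hm₂, h, hv₂⟩ := mem_voters.1 h₂
  rw [eq_of_notMem_equivocators hm₂ hm₁ h hj, hv₁] at hv₂
  cases b <;> simp at hv₂

theorem score_add_score_not_le : score b M + score (!b) M ≤ n := by
  rw [← card_voters, ← card_voters, ← Finset.card_union_of_disjoint disjoint_voters]
  exact (Finset.card_le_univ _).trans (by simp)

theorem IsQuorum.le_card (h : IsQuorum t s k M) :
    n - t ≤ (senders M \ equivocators M).card := by
  rw [Finset.card_sdiff_of_subset equivocators_subset_senders]
  have := h.2
  omega

theorem IsQuorum.exists_mem (h : IsQuorum t s k M) (hn : t < n) : ∃ m, m ∈ M := by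
  have h₁ := h.le_card
  obtain ⟨j, hj⟩ := Finset.card_pos.1 (show 0 < (senders M \ equivocators M).card by omega)
  obtain ⟨m, hm, -⟩ := mem_senders.1 (Finset.mem_sdiff.1 hj).1
  exact ⟨m, hm⟩

theorem exists_mem_of_score_pos (h : 0 < score b M) : ∃ m ∈ M, m.value = some b := by
  rw [← card_voters] at h
  obtain ⟨j, hj⟩ := Finset.card_pos.1 h
  obtain ⟨-, m, hm, -, hv⟩ := mem_voters.1 hj
  exact ⟨m, hm, hv⟩

theorem score_eq_zero (h : ∀ m ∈ M, m.value ≠ some b) : score b M = 0 := by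
  by_contra h₀
  obtain ⟨m, hm, hv⟩ := exists_mem_of_score_pos (Nat.pos_of_ne_zero h₀)
  exact h m hm hv

theorem score_le_card {C : Finset (Fin n)} (h : ∀ m ∈ M, m.value = some b → m.sender ∈ C) :
    score b M ≤ C.card := by
  rw [← card_voters]
  refine Finset.card_le_card fun j hj => ?_
  obtain ⟨-, m, hm, rfl, hv⟩ := mem_voters.1 hj
  exact h m hm hv

theorem IsQuorum.le_score_add_score (h : IsQuorum t s k M)
    (hM : ∀ m ∈ M, ∃ c, m.value = some c) (b : Bool) :
    n - t ≤ score b M + score (!b) M := by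
  refine h.le_card.trans ?_
  rw [← card_voters, ← card_voters, ← Finset.card_union_of_disjoint disjoint_voters]
  refine Finset.card_le_card fun j hj => ?_
  obtain ⟨hj₁, hj₂⟩ := Finset.mem_sdiff.1 hj
  obtain ⟨m, hm, hmj⟩ := mem_senders.1 hj₁
  obtain ⟨c, hc⟩ := hM m hm
  rw [Finset.mem_union, mem_voters, mem_voters]
  by_cases hcb : c = b
  · exact Or.inl ⟨hj₂, m, hm, hmj, hcb ▸ hc⟩
  · have : c = !b := by cases b <;> cases c <;> simp_all
    exact Or.inr ⟨hj₂, m, hm, hmj, this ▸ hc⟩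

theorem IsQuorum.le_score (h : IsQuorum t s k M) (hM : ∀ m ∈ M, m.value = some b) :
    n - t ≤ score b M := by
  have h₁ := h.le_score_add_score (fun m hm => ⟨b, hM m hm⟩) b
  rwa [score_eq_zero (b := !b) (fun m hm => by rw [hM m hm]; cases b <;> simp), add_zero] at h₁

/-- Two sets of participants that together have more than `n` elements intersect; the size of the
intersection is bounded below. -/
theorem card_add_card_le (A B : Finset (Fin n)) : A.card + B.card ≤ n + (A ∩ B).card := by
  have h₁ := Finset.card_union_add_card_inter A B
  have h₂ := Finset.card_le_univ (A ∪ B)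
  rw [Fintype.card_fin] at h₂
  omega

theorem pick_eq_some {p : Bool → Prop} (h : pick p = some b) : p b := by
  unfold pick at h
  split_ifs at h with h₁ h₂ <;> simp_all

theorem pick_eq_none {p : Bool → Prop} (h : pick p = none) (b : Bool) : ¬ p b := by
  unfold pick at h
  split_ifs at h with h₁ h₂
  cases b <;> assumption

theorem pick_eq_some_iff {p : Bool → Prop} (hp : p b → ¬ p (!b)) : pick p = some b ↔ p b := by
  refine ⟨pick_eq_some, fun h => ?_⟩
  have h' := hp h
  unfold pick
  cases b <;> simp_all

theorem score_not_estimate_le (M : List (Msg n)) (c : Bool) :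
    score (!estimate M c) M ≤ score (estimate M c) M := by
  unfold estimate
  split_ifs with h₁ h₂
  · exact h₁.le
  · exact h₂.le
  · cases c <;> simp <;> omega

end Counting

/-! ### Agreement among justified messages -/

/-- `W` is a set of messages that can be valid in one execution: its members follow the protocol,
it contains the justifications of its members, and reliable broadcast leaves at most one message
for each sender, step and kind. -/
structure Justified {n : ℕ} (t : ℕ) (W : Msg n → Prop) : Prop where
  follows : ∀ {m}, W m → Follows t m
  just : ∀ {m}, W m → ∀ m₁ ∈ m.just, W m₁
  unique : ∀ {m₁ m₂}, W m₁ → W m₂ → m₁.sender = m₂.sender → m₁.step = m₂.step →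
    m₁.kind = m₂.kind → m₁ = m₂

/-- All messages of `W` that count for the second sub-step of step `s` have value `b`. From then
on no other value can appear. -/
def Locked {n : ℕ} (W : Msg n → Prop) (s : ℕ) (b : Bool) : Prop :=
  ∀ m, W m → CountsFor s Substep.second m → m.value = some b

section Agreement

variable {n t s : ℕ} {W : Msg n → Prop} {b : Bool} {m : Msg n}

theorem Follows.first (h : Follows t m) (hk : m.kind = Kind.vote Substep.first) :
    ∃ b, m.value = some b ∧
      ((m.step = 0 ∧ m.just = []) ∨
        ∃ s, m.step = s + 1 ∧ IsQuorum t s Substep.third m.just ∧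
          (∀ c, score c m.just < 2 * t + 1) ∧
          (t + 1 ≤ score b m.just ∨ ∀ c, score c m.just < t + 1)) := by
  unfold Follows at h
  rwa [hk] at h

theorem Follows.second (h : Follows t m) (hk : m.kind = Kind.vote Substep.second) :
    ∃ b, m.value = some b ∧ IsQuorum t m.step Substep.first m.just ∧
      score (!b) m.just ≤ score b m.just := by
  unfold Follows at h
  rwa [hk] at h

theorem Follows.third (h : Follows t m) (hk : m.kind = Kind.vote Substep.third) :
    IsQuorum t m.step Substep.second m.just ∧
      ∀ b, m.value = some b ↔ n < 2 * score b m.just := by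
  unfold Follows at h
  rwa [hk] at h

theorem Follows.decision (h : Follows t m) (hk : m.kind = Kind.decision) :
    ∃ b, m.value = some b ∧ IsQuorum t m.step Substep.third m.just ∧
      2 * t + 1 ≤ score b m.just := by
  unfold Follows at h
  rwa [hk] at h

theorem CountsFor.of_lt {k : Substep} (hk : m.kind = Kind.decision) (h : m.step < s) :
    CountsFor s k m := Or.inr ⟨hk, h⟩

theorem Justified.bit_of_first (hW : Justified t W) (hm : W m)
    (hc : CountsFor s Substep.first m) : ∃ c, m.value = some c := by
  rcases hc with ⟨-, hk⟩ | ⟨hk, -⟩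
  · obtain ⟨c, hc, -⟩ := (hW.follows hm).first hk
    exact ⟨c, hc⟩
  · obtain ⟨c, hc, -⟩ := (hW.follows hm).decision hk
    exact ⟨c, hc⟩

/-- Without decisions in earlier steps, messages from one sender that count for the same sub-step
coincide. -/
theorem Justified.eq_of_countsFor (hW : Justified t W) {k : Substep} {m₁ m₂ : Msg n}
    (hd : ∀ d, W d → d.kind = Kind.decision → s ≤ d.step)
    (h₁ : W m₁) (h₂ : W m₂) (hc₁ : CountsFor s k m₁) (hc₂ : CountsFor s k m₂)
    (hs : m₁.sender = m₂.sender) : m₁ = m₂ := by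
  rcases hc₁ with ⟨hs₁, hk₁⟩ | ⟨hk, hlt⟩
  · rcases hc₂ with ⟨hs₂, hk₂⟩ | ⟨hk, hlt⟩
    · exact hW.unique h₁ h₂ hs (hs₁.trans hs₂.symm) (hk₁.trans hk₂.symm)
    · exact absurd (hd _ h₂ hk) (by omega)
  · exact absurd (hd _ h₁ hk) (by omega)

theorem Locked.third (h : Locked W s b) (hW : Justified t W) (ht : 3 * t < n) (hm : W m)
    (hc : CountsFor s Substep.third m) : m.value = some b := by
  rcases hc with ⟨hs, hk⟩ | ⟨hk, hlt⟩
  · obtain ⟨hq, hv⟩ := (hW.follows hm).third hk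
    rw [hs] at hq
    have := hq.le_score fun m₁ hm₁ => h m₁ (hW.just hm m₁ hm₁) (hq.1 m₁ hm₁)
    exact (hv b).2 (by omega)
  · exact h m hm (.of_lt hk hlt)

theorem Locked.decision (h : Locked W s b) (hW : Justified t W) (ht : 3 * t < n) (hm : W m)
    (hk : m.kind = Kind.decision) (hs : m.step ≤ s) : m.value = some b := by
  rcases hs.lt_or_eq with hlt | hs
  · exact h m hm (.of_lt hk hlt)
  · obtain ⟨c, hc, hq, hsc⟩ := (hW.follows hm).decision hk
    rw [hs] at hq
    obtain ⟨m₁, hm₁, hv⟩ := exists_mem_of_score_pos (show 0 < score c m.just by omega)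
    rw [hc, ← hv]
    exact h.third hW ht (hW.just hm m₁ hm₁) (hq.1 m₁ hm₁)

/-- After a step in which only one value was left, every participant decides, so that no vote of
the next step is justified. -/
theorem Locked.no_first (h : Locked W s b) (hW : Justified t W) (ht : 3 * t < n) (hm : W m)
    (hk : m.kind = Kind.vote Substep.first) (hs : m.step = s + 1) : False := by
  obtain ⟨c, -, ⟨h₀, -⟩ | ⟨r, hr, hq, hlt, -⟩⟩ := (hW.follows hm).first hk
  · omega
  · obtain rfl : r = s := by omega
    have h₁ := hq.le_score fun m₁ hm₁ => h.third hW ht (hW.just hm m₁ hm₁) (hq.1 m₁ hm₁)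
    have := hlt b
    omega

theorem Locked.of_first (hW : Justified t W) (ht : 3 * t < n)
    (h : ∀ m, W m → CountsFor s Substep.first m → m.value = some b) : Locked W s b := by
  rintro m hm (⟨hs, hk⟩ | ⟨hk, hlt⟩)
  · obtain ⟨c, hc, hq, hle⟩ := (hW.follows hm).second hk
    rw [hs] at hq
    have hM : ∀ m₁ ∈ m.just, m₁.value = some b := fun m₁ hm₁ =>
      h m₁ (hW.just hm m₁ hm₁) (hq.1 m₁ hm₁)
    have h₁ := hq.le_score hM
    have h₂ : score (!b) m.just = 0 := score_eq_zero fun m₁ hm₁ => by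
      rw [hM m₁ hm₁]; cases b <;> simp
    rw [hc]
    by_contra hne
    have hcb : c = !b := by cases b <;> cases c <;> simp_all
    subst hcb
    rw [Bool.not_not] at hle
    omega
  · exact h m hm (.of_lt hk hlt)

theorem Locked.succ (h : Locked W s b) (hW : Justified t W) (ht : 3 * t < n) :
    Locked W (s + 1) b := by
  refine .of_first hW ht ?_
  rintro m hm (⟨hs, hk⟩ | ⟨hk, hlt⟩)
  · exact (h.no_first hW ht hm hk hs).elim
  · exact h.decision hW ht hm hk (by omega)

theorem Locked.mono (h : Locked W s b) (hW : Justified t W) (ht : 3 * t < n) {r : ℕ}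
    (hr : s ≤ r) : Locked W r b := by
  induction r, hr using Nat.le_induction with
  | base => exact h
  | succ r _ ih => exact ih.succ hW ht

/-- If all participants outside `C` vote for `b` in the first sub-step and earlier decisions are
`b`, then the at most `t` members of `C` cannot turn the estimate of any quorum. -/
theorem Locked.of_honest_first (hW : Justified t W) (ht : 3 * t < n) {C : Finset (Fin n)}
    (hC : C.card ≤ t)
    (h : ∀ m, W m → m.step = s → m.kind = Kind.vote Substep.first → m.sender ∉ C →
      m.value = some b)
    (hd : ∀ m, W m → m.kind = Kind.decision → m.step < s → m.value = some b) :
    Locked W s b := by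
  rintro m hm (⟨hs, hk⟩ | ⟨hk, hlt⟩)
  · obtain ⟨c, hc, hq, hle⟩ := (hW.follows hm).second hk
    rw [hs] at hq
    have h₁ := hq.le_score_add_score
      (fun m₁ hm₁ => hW.bit_of_first (hW.just hm m₁ hm₁) (hq.1 m₁ hm₁)) b
    have h₂ : score (!b) m.just ≤ C.card := score_le_card fun m₁ hm₁ hv => by
      by_contra hns
      have : m₁.value = some b := by
        rcases hq.1 m₁ hm₁ with ⟨hs₁, hk₁⟩ | ⟨hk₁, hlt⟩
        · exact h m₁ (hW.just hm m₁ hm₁) hs₁ hk₁ hns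
        · exact hd m₁ (hW.just hm m₁ hm₁) hk₁ hlt
      rw [this] at hv
      cases b <;> simp at hv
    rw [hc]
    by_contra hne
    have hcb : c = !b := by cases b <;> cases c <;> simp_all
    subst hcb
    rw [Bool.not_not] at hle
    omega
  · exact hd m hm hk hlt

/-- Two majorities intersect. -/
theorem Justified.third_agree_of_no_decision (hW : Justified t W) {m₁ m₂ : Msg n} {b₁ b₂ : Bool}
    (hd : ∀ d, W d → d.kind = Kind.decision → s ≤ d.step)
    (h₁ : W m₁) (h₂ : W m₂) (hc₁ : CountsFor s Substep.third m₁)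
    (hc₂ : CountsFor s Substep.third m₂) (hv₁ : m₁.value = some b₁) (hv₂ : m₂.value = some b₂) :
    b₁ = b₂ := by
  rcases hc₁ with ⟨hs₁, hk₁⟩ | ⟨hk, hlt⟩
  swap
  · exact absurd (hd _ h₁ hk) (by omega)
  rcases hc₂ with ⟨hs₂, hk₂⟩ | ⟨hk, hlt⟩
  swap
  · exact absurd (hd _ h₂ hk) (by omega)
  obtain ⟨hq₁, hw₁⟩ := (hW.follows h₁).third hk₁
  obtain ⟨hq₂, hw₂⟩ := (hW.follows h₂).third hk₂
  have hlt₁ := (hw₁ b₁).1 hv₁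
  have hlt₂ := (hw₂ b₂).1 hv₂
  rw [← card_voters] at hlt₁ hlt₂
  have := card_add_card_le (voters b₁ m₁.just) (voters b₂ m₂.just)
  obtain ⟨j, hj⟩ := Finset.card_pos.1
    (show 0 < (voters b₁ m₁.just ∩ voters b₂ m₂.just).card by omega)
  obtain ⟨hj₁, hj₂⟩ := Finset.mem_inter.1 hj
  obtain ⟨-, p₁, hp₁, hpj₁, hpv₁⟩ := mem_voters.1 hj₁
  obtain ⟨-, p₂, hp₂, hpj₂, hpv₂⟩ := mem_voters.1 hj₂
  have hp := hW.eq_of_countsFor hd (hW.just h₁ p₁ hp₁) (hW.just h₂ p₂ hp₂)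
    (hs₁ ▸ hq₁.1 p₁ hp₁) (hs₂ ▸ hq₂.1 p₂ hp₂) (hpj₁.trans hpj₂.symm)
  rw [hp, hpv₂] at hpv₁
  exact (Option.some.inj hpv₁).symm

/-- The earliest decision locks its value: its quorum of `2t + 1` votes shares `t + 1` voters with
every other quorum. -/
theorem Justified.locked_of_first_decision (hW : Justified t W) (ht : 3 * t < n)
    (hd : ∀ d, W d → d.kind = Kind.decision → s ≤ d.step)
    (hm : W m) (hk : m.kind = Kind.decision) (hs : m.step = s) (hv : m.value = some b) :
    Locked W (s + 1) b := by
  obtain ⟨c, hc, hq, hsc⟩ := (hW.follows hm).decision hk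
  obtain rfl : b = c := by rw [hv] at hc; exact Option.some.inj hc
  rw [hs] at hq
  obtain ⟨p, hp, hpv⟩ := exists_mem_of_score_pos (show 0 < score b m.just by omega)
  have hall : ∀ p' c, W p' → CountsFor s Substep.third p' → p'.value = some c → c = b :=
    fun p' c h hcf hpc =>
      hW.third_agree_of_no_decision hd h (hW.just hm p hp) hcf (hq.1 p hp) hpc hpv
  refine .of_first hW ht ?_
  rintro m' hm' (⟨hs', hk'⟩ | ⟨hk', hlt'⟩)
  · obtain ⟨c, hc, ⟨h₀, -⟩ | ⟨r, hr, hq', -, hor⟩⟩ := (hW.follows hm').first hk'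
    · omega
    obtain rfl : r = s := by omega
    have hb : t + 1 ≤ score b m'.just := by
      have h₁ := hq'.le_card
      have h₂ := card_add_card_le (voters b m.just) (senders m'.just \ equivocators m'.just)
      rw [card_voters] at h₂
      have h₃ : voters b m.just ∩ (senders m'.just \ equivocators m'.just) ⊆
          voters b m'.just := by
        intro j hj
        obtain ⟨hj₁, hj₂⟩ := Finset.mem_inter.1 hj
        obtain ⟨hj₂, hj₃⟩ := Finset.mem_sdiff.1 hj₂
        obtain ⟨-, p₁, hp₁, hpj₁, hpv₁⟩ := mem_voters.1 hj₁
        obtain ⟨p₂, hp₂, hpj₂⟩ := mem_senders.1 hj₂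
        have := hW.eq_of_countsFor hd (hW.just hm p₁ hp₁) (hW.just hm' p₂ hp₂)
          (hq.1 p₁ hp₁) (hq'.1 p₂ hp₂) (hpj₁.trans hpj₂.symm)
        exact mem_voters.2 ⟨hj₃, p₂, hp₂, hpj₂, this ▸ hpv₁⟩
      have h₄ := Finset.card_le_card h₃
      rw [card_voters] at h₄
      omega
    rw [hc]
    rcases hor with hor | hor
    · obtain ⟨p', hp', hpv'⟩ := exists_mem_of_score_pos (show 0 < score c m'.just by omega)
      rw [hall p' c (hW.just hm' p' hp') (hq'.1 p' hp') hpv']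
    · exact absurd (hor b) (by omega)
  · have hs' : m'.step = s := le_antisymm (by omega) (hd m' hm' hk')
    obtain ⟨c, hc, hq', hsc'⟩ := (hW.follows hm').decision hk'
    rw [hs'] at hq'
    obtain ⟨p', hp', hpv'⟩ := exists_mem_of_score_pos (show 0 < score c m'.just by omega)
    rw [hc, hall p' c (hW.just hm' p' hp') (hq'.1 p' hp') hpv']

theorem Justified.locked_of_decision (hW : Justified t W) (ht : 3 * t < n)
    (hm : W m) (hk : m.kind = Kind.decision) (hv : m.value = some b) :
    Locked W (m.step + 1) b := by
  classical
  have hex : ∃ s, ∃ d, W d ∧ d.kind = Kind.decision ∧ d.step = s := ⟨_, m, hm, hk, rfl⟩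
  obtain ⟨d, hd, hdk, hds⟩ := Nat.find_spec hex
  have hmin : ∀ d, W d → d.kind = Kind.decision → Nat.find hex ≤ d.step :=
    fun d hd hk => Nat.find_min' hex ⟨d, hd, hk, rfl⟩
  obtain ⟨c, hc, -⟩ := (hW.follows hd).decision hdk
  have hL := (hW.locked_of_first_decision ht hmin hd hdk hds hc).mono hW ht
    (Nat.succ_le_succ (hmin m hm hk))
  have hmc := hL m hm (.of_lt hk (Nat.lt_succ_self _))
  rw [hv] at hmc
  rwa [Option.some.inj hmc]

theorem Justified.decision_agree (hW : Justified t W) (ht : 3 * t < n) {m₁ m₂ : Msg n}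
    {b₁ b₂ : Bool} (h₁ : W m₁) (h₂ : W m₂) (hk₁ : m₁.kind = Kind.decision)
    (hk₂ : m₂.kind = Kind.decision) (hv₁ : m₁.value = some b₁) (hv₂ : m₂.value = some b₂) :
    b₁ = b₂ := by
  have hL₁ := (hW.locked_of_decision ht h₁ hk₁ hv₁).mono hW ht
    (show m₁.step + 1 ≤ max m₁.step m₂.step + 1 by omega)
  have := hL₁ m₂ h₂ (.of_lt hk₂ (by omega))
  rw [hv₂] at this
  exact (Option.some.inj this).symm

theorem Justified.third_of_decision (hW : Justified t W) (ht : 3 * t < n) {d : Msg n}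
    (hd : W d) (hk : d.kind = Kind.decision) (hv : d.value = some b) (hs : d.step < s)
    (hm : W m) (hc : CountsFor s Substep.third m) : m.value = some b :=
  ((hW.locked_of_decision ht hd hk hv).mono hW ht hs).third hW ht hm hc

theorem Justified.third_agree (hW : Justified t W) (ht : 3 * t < n) {m₁ m₂ : Msg n} {b₁ b₂ : Bool}
    (h₁ : W m₁) (h₂ : W m₂) (hc₁ : CountsFor s Substep.third m₁)
    (hc₂ : CountsFor s Substep.third m₂) (hv₁ : m₁.value = some b₁) (hv₂ : m₂.value = some b₂) :
    b₁ = b₂ := by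
  by_cases hd : ∀ d, W d → d.kind = Kind.decision → s ≤ d.step
  · exact hW.third_agree_of_no_decision hd h₁ h₂ hc₁ hc₂ hv₁ hv₂
  · push Not at hd
    obtain ⟨d, hd, hk, hs⟩ := hd
    obtain ⟨c, hc, -⟩ := (hW.follows hd).decision hk
    have e₁ := hW.third_of_decision ht hd hk hc hs h₁ hc₁
    have e₂ := hW.third_of_decision ht hd hk hc hs h₂ hc₂
    rw [hv₁] at e₁
    rw [hv₂, ← e₁] at e₂
    exact (Option.some.inj e₂).symm

/-- If one participant can finish the third sub-step without seeing `c`, then no other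
participant sees more than `t` votes for `c`. -/
theorem Justified.score_le_of_quorum (hW : Justified t W) (ht : 3 * t < n)
    {M M' : List (Msg n)} {c : Bool} (hM : ∀ m ∈ M, W m) (hM' : ∀ m ∈ M', W m)
    (hq : IsQuorum t s Substep.third M) (hc : ∀ m ∈ M, m.value ≠ some c)
    (hq' : ∀ m ∈ M', CountsFor s Substep.third m) : score c M' ≤ t := by
  by_cases hd : ∀ d, W d → d.kind = Kind.decision → s ≤ d.step
  · have h₁ := hq.le_card
    have h₂ := card_add_card_le (voters c M') (senders M \ equivocators M)
    have h₃ : voters c M' ∩ (senders M \ equivocators M) = ∅ := by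
      rw [Finset.eq_empty_iff_forall_notMem]
      intro j hj
      obtain ⟨hj₁, hj₂⟩ := Finset.mem_inter.1 hj
      obtain ⟨-, p₁, hp₁, hpj₁, hpv₁⟩ := mem_voters.1 hj₁
      obtain ⟨p₂, hp₂, hpj₂⟩ := mem_senders.1 (Finset.mem_sdiff.1 hj₂).1
      have := hW.eq_of_countsFor hd (hM' p₁ hp₁) (hM p₂ hp₂)
        (hq' p₁ hp₁) (hq.1 p₂ hp₂) (hpj₁.trans hpj₂.symm)
      exact hc p₂ hp₂ (this ▸ hpv₁)
    rw [h₃, card_voters, Finset.card_empty] at h₂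
    omega
  · push Not at hd
    obtain ⟨d, hd, hk, hs⟩ := hd
    obtain ⟨e, he, -⟩ := (hW.follows hd).decision hk
    obtain ⟨p, hp⟩ := hq.exists_mem (by omega)
    have hpe := hW.third_of_decision ht hd hk he hs (hM p hp) (hq.1 p hp)
    rw [score_eq_zero]
    · exact Nat.zero_le _
    · intro m hm h
      rw [hW.third_of_decision ht hd hk he hs (hM' m hm) (hq' m hm), ← hpe] at h
      exact hc p hp h

/-- Let `M` be a quorum of third votes of step `s`, and let `b` occur among the third votes or `!b`
not occur in `M`. Then no quorum has more than `t` votes for `!b`. So if all participants outside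
`C` replace an undetermined value by `b`, then `b` is locked in the next step. -/
theorem Justified.locked_of_coin (hW : Justified t W) (ht : 3 * t < n) {C : Finset (Fin n)}
    (hC : C.card ≤ t) {M : List (Msg n)} (hM : ∀ m ∈ M, W m)
    (hq : IsQuorum t s Substep.third M)
    (hb : (∃ m, W m ∧ CountsFor s Substep.third m ∧ m.value = some b) ∨
      ∀ m ∈ M, m.value ≠ some !b)
    (hf : ∀ m, W m → m.step = s + 1 → m.kind = Kind.vote Substep.first → m.sender ∉ C →
      m.value = some ((pick fun c => t + 1 ≤ score c m.just).getD b)) :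
    Locked W (s + 1) b := by
  have hsc : ∀ M' : List (Msg n), (∀ m ∈ M', W m) → (∀ m ∈ M', CountsFor s Substep.third m) →
      score (!b) M' ≤ t := by
    intro M' hM' hq'
    rcases hb with ⟨m, hm, hmc, hmv⟩ | hb
    · rw [score_eq_zero]
      · exact Nat.zero_le _
      · intro m' hm' hv'
        have := hW.third_agree ht hm (hM' m' hm') hmc (hq' m' hm') hmv hv'
        cases b <;> simp at this
    · exact hW.score_le_of_quorum ht hM hM' hq hb hq'
  refine .of_honest_first hW ht hC ?_ ?_
  · intro m hm hs hk hmC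
    rw [hf m hm hs hk hmC]
    obtain ⟨c, -, ⟨h₀, -⟩ | ⟨r, hr, hq', -, -⟩⟩ := (hW.follows hm).first hk
    · omega
    obtain rfl : r = s := by omega
    rcases hp : pick fun c => t + 1 ≤ score c m.just with _ | c
    · rfl
    · have h₁ := pick_eq_some hp
      by_cases hcb : c = b
      · rw [hcb]; rfl
      · have hcb : c = !b := by cases b <;> cases c <;> simp_all
        subst hcb
        have := hsc m.just (hW.just hm) hq'.1
        omega
  · intro m hm hk hs
    obtain ⟨c, hc, hq', hsc'⟩ := (hW.follows hm).decision hk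
    rw [hc]
    by_contra hne
    have hcb : c = !b := by cases b <;> cases c <;> simp_all
    subst hcb
    rcases (Nat.lt_succ_iff.1 hs).lt_or_eq with hlt | hs
    · rcases hb with ⟨p, hp, hpc, hpv⟩ | hb
      · rw [hW.third_of_decision ht hm hk hc hlt hp hpc] at hpv
        cases b <;> simp at hpv
      · obtain ⟨p, hp⟩ := hq.exists_mem (by omega)
        exact hb p hp (hW.third_of_decision ht hm hk hc hlt (hM p hp) (hq.1 p hp))
    · rw [hs] at hq'
      have := hsc m.just (hW.just hm) hq'.1
      omega

end Agreement

/-! ### Local states and single actions -/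

/-- The place of a sub-step within its step. -/
def Substep.index : Substep → ℕ
  | first => 0
  | second => 1
  | third => 2

theorem Substep.index_lt (k : Substep) : k.index < 3 := by
  cases k <;> simp [index]

theorem Substep.index_injective : Function.Injective index := by
  intro k k' h
  cases k <;> cases k' <;> simp [index] at h <;> rfl

namespace LocalState

/-- The protocol step in which a participant is, or in which it has decided. -/
def step : LocalState → ℕ
  | waiting s _ => s
  | decided s _ => s

/-- The number of sub-steps that a participant has finished. -/
def position : LocalState → ℕ
  | waiting s k => 3 * s + k.index
  | decided s _ => 3 * s + 3

/-- A participant in the state `st` has broadcast its vote of sub-step `k` of step `s`. -/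
def Reached (st : LocalState) (s : ℕ) (k : Substep) : Prop :=
  match st with
  | waiting s' k' => 3 * s + k.index ≤ 3 * s' + k'.index
  | decided s' _ => s ≤ s'

/-- A participant in this state has decided. -/
def IsDecided (st : LocalState) : Prop := ∃ s b, st = decided s b

end LocalState

open LocalState

section Finish

variable {n t : ℕ} {coin coin' : ℕ → Flip → Fin n → Bool} {i : Fin n} {s : ℕ} {k : Substep}
  {M : List (Msg n)}

theorem sender_finishSubstep : (finishSubstep t coin i s k M).2.sender = i := by
  unfold finishSubstep
  rcases k with _ | _ | _ <;> dsimp only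
  split <;> rfl

theorem just_finishSubstep : (finishSubstep t coin i s k M).2.just = M := by
  unfold finishSubstep
  rcases k with _ | _ | _ <;> dsimp only
  split <;> rfl

theorem follows_finishSubstep (hq : IsQuorum t s k M) :
    Follows t (finishSubstep t coin i s k M).2 := by
  unfold finishSubstep
  rcases k with _ | _ | _ <;> dsimp only
  · exact ⟨_, rfl, hq, score_not_estimate_le _ _⟩
  · refine ⟨hq, fun b => pick_eq_some_iff (p := fun b => n < 2 * score b M) fun h₁ h₂ => ?_⟩
    have := score_add_score_not_le (b := b) (M := M)
    omega
  · split
    · rename_i b hb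
      exact ⟨b, rfl, hq, pick_eq_some hb⟩
    · rename_i hb
      refine ⟨_, rfl, Or.inr ⟨s, rfl, hq, fun c => not_le.1 (pick_eq_none hb c), ?_⟩⟩
      dsimp only
      rcases hp : pick fun b => t + 1 ≤ score b M with _ | c
      · exact Or.inr fun c => not_le.1 (pick_eq_none hp c)
      · exact Or.inl (pick_eq_some (p := fun b => t + 1 ≤ score b M) hp)

theorem reached_finishSubstep {s' : ℕ} {k' : Substep} :
    Reached (finishSubstep t coin i s k M).1 s' k' ↔
      Reached (waiting s k) s' k' ∨ ((finishSubstep t coin i s k M).2.step = s' ∧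
        (finishSubstep t coin i s k M).2.kind = Kind.vote k') := by
  unfold finishSubstep
  rcases k with _ | _ | _ <;> dsimp only
  · rcases k' with _ | _ | _ <;> simp [Reached, Substep.index] <;> omega
  · rcases k' with _ | _ | _ <;> simp [Reached, Substep.index] <;> omega
  · split
    · rcases k' with _ | _ | _ <;> simp [Reached, Substep.index] <;> omega
    · rcases k' with _ | _ | _ <;> simp [Reached, Substep.index] <;> omega

theorem not_reached_finishSubstep {k' : Substep}
    (h : (finishSubstep t coin i s k M).2.kind = Kind.vote k') :
    ¬ Reached (waiting s k) (finishSubstep t coin i s k M).2.step k' := by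
  unfold finishSubstep at h ⊢
  rcases k with _ | _ | _ <;> dsimp only at h ⊢
  · cases h
    simp [Reached, Substep.index]
  · cases h
    simp [Reached, Substep.index]
  · split at h
    · cases h
    · cases h
      simp [Reached, Substep.index]
      omega

theorem finishSubstep_eq_decided {s' : ℕ} {b : Bool} :
    (finishSubstep t coin i s k M).1 = decided s' b ↔
      (finishSubstep t coin i s k M).2.step = s' ∧
      (finishSubstep t coin i s k M).2.kind = Kind.decision ∧
      (finishSubstep t coin i s k M).2.value = some b := by
  unfold finishSubstep
  rcases k with _ | _ | _ <;> dsimp only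
  · simp
  · simp
  · split <;> simp

theorem step_finishSubstep_ne_zero
    (h : (finishSubstep t coin i s k M).2.kind = Kind.vote Substep.first) :
    (finishSubstep t coin i s k M).2.step ≠ 0 := by
  unfold finishSubstep at h ⊢
  rcases k with _ | _ | _ <;> dsimp only at h ⊢
  · cases h
  · cases h
  · split at h
    · cases h
    · simp

theorem value_finishSubstep_first {s' : ℕ}
    (h : (finishSubstep t coin i s k M).2.kind = Kind.vote Substep.first)
    (hs : (finishSubstep t coin i s k M).2.step = s' + 1) :
    (finishSubstep t coin i s k M).2.value =
      some ((pick fun b => t + 1 ≤ score b M).getD (coin s' Flip.final i)) := by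
  unfold finishSubstep at h hs ⊢
  rcases k with _ | _ | _ <;> dsimp only at h hs ⊢
  · cases h
  · cases h
  · rcases hp : pick fun b => 2 * t + 1 ≤ score b M with _ | c
    · rw [hp] at hs
      obtain rfl : s = s' := Nat.succ.inj hs
      rfl
    · rw [hp] at h
      cases h

theorem position_finishSubstep :
    (finishSubstep t coin i s k M).1.position = (waiting s k).position + 1 := by
  unfold finishSubstep
  rcases k with _ | _ | _ <;> dsimp only
  · rfl
  · rfl
  · split
    · simp [position, Substep.index]
    · simp [position, Substep.index]
      omega

theorem le_step_finishSubstep : s ≤ (finishSubstep t coin i s k M).1.step := by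
  unfold finishSubstep
  rcases k with _ | _ | _ <;> dsimp only
  · rfl
  · rfl
  · split <;> simp [step]

theorem step_finishSubstep_le : (finishSubstep t coin i s k M).1.step ≤ s + 1 := by
  unfold finishSubstep
  rcases k with _ | _ | _ <;> dsimp only
  · simp [step]
  · simp [step]
  · split <;> simp [step]

theorem eq_third_of_lt_step (h : s < (finishSubstep t coin i s k M).1.step) :
    k = Substep.third := by
  unfold finishSubstep at h
  rcases k with _ | _ | _ <;> simp [step] at h ⊢

/-- The coin that a participant reads at the end of step `s` matters only if it moves on. -/
theorem finishSubstep_congr (h₁ : coin s Flip.tie i = coin' s Flip.tie i)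
    (h₂ : s < (finishSubstep t coin i s k M).1.step →
      coin s Flip.final i = coin' s Flip.final i) :
    finishSubstep t coin i s k M = finishSubstep t coin' i s k M := by
  unfold finishSubstep at h₂ ⊢
  rcases k with _ | _ | _ <;> dsimp only at h₂ ⊢
  · rw [h₁]
  · split
    · rfl
    · rename_i hp
      rw [hp] at h₂
      rw [h₂ (by simp [step])]

end Finish

/-- The possible effects of one action. -/
inductive Transition {n : ℕ} (t : ℕ) (corrupt : Finset (Fin n))
    (coin : ℕ → Flip → Fin n → Bool) : Config n → Config n → Prop
  | stay (c : Config n) : Transition t corrupt coin c c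
  | broadcast (c : Config n) (m : Msg n) (hm : m.sender ∈ corrupt)
      (hf : ∀ m₁ ∈ c.sent, ¬ (m₁.sender = m.sender ∧ m₁.step = m.step ∧ m₁.kind = m.kind)) :
      Transition t corrupt coin c { c with sent := m :: c.sent }
  | deliver (c : Config n) (i : Fin n) (m : Msg n) (hm : m ∈ c.sent) :
      Transition t corrupt coin c
        { c with received := Function.update c.received i (m :: c.received i) }
  | finish (c : Config n) (i : Fin n) (s : ℕ) (k : Substep) (hi : i ∉ corrupt)
      (hst : c.state i = waiting s k)
      (hq : IsQuorum t s k (messageSet t (c.received i) s k)) :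
      Transition t corrupt coin c
        { c with
          state := Function.update c.state i
            (finishSubstep t coin i s k (messageSet t (c.received i) s k)).1
          sent := (finishSubstep t coin i s k (messageSet t (c.received i) s k)).2 :: c.sent }

section Messages

variable {n t : ℕ} {V V' : List (Msg n)} {m : Msg n} {s : ℕ} {k : Substep}

theorem Valid.mem (h : Valid t V m) : m ∈ V := by cases h; assumption

theorem Valid.follows (h : Valid t V m) : Follows t m := by cases h; assumption

theorem Valid.just (h : Valid t V m) : ∀ m₁ ∈ m.just, Valid t V m₁ := by cases h; assumption

theorem Valid.mono (hV : ∀ m ∈ V, m ∈ V') (h : Valid t V m) : Valid t V' m := by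
  induction h with
  | intro m hm hf _ ih => exact .intro m (hV m hm) hf ih

theorem mem_messageSet : m ∈ messageSet t V s k ↔ Valid t V m ∧ CountsFor s k m := by
  simp only [messageSet, List.mem_filter, decide_eq_true_eq]
  exact ⟨fun h => h.2, fun h => ⟨h.1.mem, h⟩⟩

end Messages

section Execution

variable {n t : ℕ} {corrupt : Finset (Fin n)} {input : Fin n → Bool} {adv : Adversary n}
  {coin coin' : ℕ → Flip → Fin n → Bool} {c c' : Config n} {i : Fin n}

theorem transition_applyAction (c : Config n) (a : Action n) :
    Transition t corrupt coin c (applyAction t corrupt coin c a) := by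
  rcases a with m | ⟨i, m⟩ | i
  · simp only [applyAction]
    split_ifs with h
    · exact .broadcast c m h.1 h.2
    · exact .stay c
  · simp only [applyAction]
    split_ifs with h
    · exact .deliver c i m h.1
    · exact .stay c
  · simp only [applyAction]
    split_ifs with hi
    · exact .stay c
    · split
      · exact .stay c
      · rename_i s k hst
        split_ifs with hq
        · exact .finish c i s k hi hst hq
        · exact .stay c

namespace Transition

theorem sent_subset (h : Transition t corrupt coin c c') {m : Msg n} (hm : m ∈ c.sent) :
    m ∈ c'.sent := by
  cases h with
  | stay => exact hm
  | broadcast => exact List.mem_cons_of_mem _ hm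
  | deliver => exact hm
  | finish => exact List.mem_cons_of_mem _ hm

theorem received_subset (h : Transition t corrupt coin c c') {m : Msg n}
    (hm : m ∈ c.received i) : m ∈ c'.received i := by
  cases h with
  | stay => exact hm
  | broadcast => exact hm
  | deliver j m' =>
    by_cases hij : i = j
    · subst hij
      simp only [Function.update_self]
      exact List.mem_cons_of_mem _ hm
    · simpa only [Function.update_of_ne hij] using hm
  | finish => exact hm

theorem step_le (h : Transition t corrupt coin c c') (i : Fin n) :
    (c.state i).step ≤ (c'.state i).step := by
  cases h with
  | stay => rfl
  | broadcast => rfl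
  | deliver => rfl
  | finish j s k hj hst =>
    by_cases hij : i = j
    · subst hij
      simp only [Function.update_self, hst]
      exact le_step_finishSubstep
    · simp only [Function.update_of_ne hij]; rfl

theorem step_le_succ (h : Transition t corrupt coin c c') (i : Fin n) :
    (c'.state i).step ≤ (c.state i).step + 1 := by
  cases h with
  | stay => exact Nat.le_succ _
  | broadcast => exact Nat.le_succ _
  | deliver => exact Nat.le_succ _
  | finish j s k hj hst =>
    by_cases hij : i = j
    · subst hij
      simp only [Function.update_self, hst]
      exact step_finishSubstep_le
    · simp only [Function.update_of_ne hij]; exact Nat.le_succ _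

theorem position_le (h : Transition t corrupt coin c c') (i : Fin n) :
    (c.state i).position ≤ (c'.state i).position := by
  cases h with
  | stay => rfl
  | broadcast => rfl
  | deliver => rfl
  | finish j s k hj hst =>
    by_cases hij : i = j
    · subst hij
      simp only [Function.update_self, hst, position_finishSubstep]
      exact Nat.le_succ _
    · simp only [Function.update_of_ne hij]; rfl

theorem decided (h : Transition t corrupt coin c c') {s : ℕ} {b : Bool}
    (hd : c.state i = decided s b) : c'.state i = LocalState.decided s b := by
  cases h with
  | stay => exact hd
  | broadcast => exact hd
  | deliver => exact hd
  | finish j s k hj hst =>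
    by_cases hij : i = j
    · subst hij
      rw [hd] at hst
      cases hst
    · simpa only [Function.update_of_ne hij] using hd

end Transition

/-- What holds at all times of an execution: the messages of an honest participant are valid and
are those that belong to its state, and broadcasts are reliable. -/
structure Invariant (t : ℕ) (corrupt : Finset (Fin n)) (input : Fin n → Bool)
    (coin : ℕ → Flip → Fin n → Bool) (c : Config n) : Prop where
  received_subset : ∀ i, ∀ m ∈ c.received i, m ∈ c.sent
  unique : ∀ m₁ ∈ c.sent, ∀ m₂ ∈ c.sent, m₁.sender = m₂.sender → m₁.step = m₂.step →
    m₁.kind = m₂.kind → m₁ = m₂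
  valid : ∀ m ∈ c.sent, m.sender ∉ corrupt → Valid t c.sent m
  reached : ∀ i, i ∉ corrupt → ∀ s k, Reached (c.state i) s k ↔
    ∃ m ∈ c.sent, m.sender = i ∧ m.step = s ∧ m.kind = Kind.vote k
  decided : ∀ i, i ∉ corrupt → ∀ s b, c.state i = decided s b ↔
    ∃ m ∈ c.sent, m.sender = i ∧ m.step = s ∧ m.kind = Kind.decision ∧ m.value = some b
  first_zero : ∀ m ∈ c.sent, m.sender ∉ corrupt → m.kind = Kind.vote Substep.first →
    m.step = 0 → m.value = some (input m.sender)
  first_succ : ∀ m ∈ c.sent, m.sender ∉ corrupt → m.kind = Kind.vote Substep.first →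
    ∀ s, m.step = s + 1 → m.value =
      some ((pick fun b => t + 1 ≤ score b m.just).getD (coin s Flip.final m.sender))

theorem invariant_startConfig : Invariant t corrupt input coin (startConfig corrupt input) := by
  have hmem : ∀ m : Msg n, m ∈ (startConfig corrupt input).sent ↔
      ∃ i, i ∉ corrupt ∧ m = ⟨i, 0, Kind.vote Substep.first, some (input i), []⟩ := by
    intro m
    simp only [startConfig, List.mem_map, List.mem_filter, List.mem_finRange, true_and,
      decide_eq_true_eq]
    exact exists_congr fun i => and_congr_right fun _ => eq_comm
  constructor
  · intro i m hm
    simp [startConfig] at hm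
  · intro m₁ h₁ m₂ h₂ hs _ _
    obtain ⟨i, -, rfl⟩ := (hmem _).1 h₁
    obtain ⟨j, -, rfl⟩ := (hmem _).1 h₂
    obtain rfl : i = j := hs
    rfl
  · intro m hm _
    refine .intro m hm ?_ ?_
    · obtain ⟨i, -, rfl⟩ := (hmem _).1 hm
      exact ⟨_, rfl, Or.inl ⟨rfl, rfl⟩⟩
    · obtain ⟨i, -, rfl⟩ := (hmem _).1 hm
      simp
  · intro i hi s k
    constructor
    · intro h
      have h' : 3 * s + k.index ≤ 0 := h
      obtain rfl : s = 0 := by omega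
      obtain rfl : k = Substep.first :=
        Substep.index_injective (show k.index = 0 by omega)
      exact ⟨_, (hmem _).2 ⟨i, hi, rfl⟩, rfl, rfl, rfl⟩
    · rintro ⟨m, hm, -, rfl, hk⟩
      obtain ⟨j, -, rfl⟩ := (hmem _).1 hm
      cases hk
      exact Nat.le_refl 0
  · intro i hi s b
    constructor
    · intro h
      cases h
    · rintro ⟨m, hm, -, -, hk, -⟩
      obtain ⟨j, -, rfl⟩ := (hmem _).1 hm
      cases hk
  · intro m hm _ _ _
    obtain ⟨j, -, rfl⟩ := (hmem _).1 hm
    rfl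
  · intro m hm _ _ s hs
    obtain ⟨j, -, rfl⟩ := (hmem _).1 hm
    cases hs

theorem Invariant.transition (h : Invariant t corrupt input coin c)
    (ht : Transition t corrupt coin c c') : Invariant t corrupt input coin c' := by
  have hmono : ∀ m ∈ c.sent, m ∈ c'.sent := fun m hm => ht.sent_subset hm
  cases ht with
  | stay => exact h
  | broadcast m hm hf =>
    have hhon : ∀ m₁ ∈ m :: c.sent, m₁.sender ∉ corrupt → m₁ ∈ c.sent := by
      intro m₁ hm₁ hc
      rcases List.mem_cons.1 hm₁ with rfl | hm₁
      · exact absurd hm hc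
      · exact hm₁
    constructor
    · exact fun i m hm => hmono m (h.received_subset i m hm)
    · intro m₁ h₁ m₂ h₂ e₁ e₂ e₃
      rcases List.mem_cons.1 h₁ with rfl | h₁'
      · rcases List.mem_cons.1 h₂ with rfl | h₂'
        · rfl
        · exact absurd ⟨e₁.symm, e₂.symm, e₃.symm⟩ (hf m₂ h₂')
      · rcases List.mem_cons.1 h₂ with rfl | h₂'
        · exact absurd ⟨e₁, e₂, e₃⟩ (hf m₁ h₁')
        · exact h.unique m₁ h₁' m₂ h₂' e₁ e₂ e₃
    · exact fun m₁ hm₁ hc => (h.valid m₁ (hhon m₁ hm₁ hc) hc).mono hmono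
    · intro i hi s k
      refine (h.reached i hi s k).trans ⟨?_, ?_⟩
      · rintro ⟨m₁, hm₁, e⟩
        exact ⟨m₁, hmono _ hm₁, e⟩
      · rintro ⟨m₁, hm₁, rfl, e⟩
        exact ⟨m₁, hhon m₁ hm₁ hi, rfl, e⟩
    · intro i hi s b
      refine (h.decided i hi s b).trans ⟨?_, ?_⟩
      · rintro ⟨m₁, hm₁, e⟩
        exact ⟨m₁, hmono _ hm₁, e⟩
      · rintro ⟨m₁, hm₁, rfl, e⟩
        exact ⟨m₁, hhon m₁ hm₁ hi, rfl, e⟩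
    · exact fun m₁ hm₁ hc => h.first_zero m₁ (hhon m₁ hm₁ hc) hc
    · exact fun m₁ hm₁ hc => h.first_succ m₁ (hhon m₁ hm₁ hc) hc
  | deliver i m hm =>
    refine ⟨?_, h.unique, h.valid, h.reached, h.decided, h.first_zero, h.first_succ⟩
    intro j m' hm'
    by_cases hij : j = i
    · subst hij
      simp only [Function.update_self] at hm'
      rcases List.mem_cons.1 hm' with rfl | hm'
      · exact hm
      · exact h.received_subset _ _ hm'
    · simp only [Function.update_of_ne hij] at hm'
      exact h.received_subset _ _ hm'
  | finish i s k hi hst hq =>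
    set M := messageSet t (c.received i) s k with hM
    set r := finishSubstep t coin i s k M with hr
    have hri : r.2.sender = i := sender_finishSubstep
    -- The new message differs in its step or its kind from the earlier messages of `i`.
    have hnew : ∀ m ∈ c.sent, ¬ (m.sender = r.2.sender ∧ m.step = r.2.step ∧
        m.kind = r.2.kind) := by
      rintro m hm ⟨e₁, e₂, e₃⟩
      rw [hri] at e₁
      rcases hk : r.2.kind with k' | _
      · refine not_reached_finishSubstep (coin := coin) hk ?_
        rw [← hst]
        exact (h.reached i hi _ _).2 ⟨m, hm, e₁, e₂, e₃.trans hk⟩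
      · obtain ⟨b, hb, -⟩ := (h.valid m hm (e₁ ▸ hi)).follows.decision (e₃.trans hk)
        have := (h.decided i hi _ b).2 ⟨m, hm, e₁, rfl, e₃.trans hk, hb⟩
        rw [hst] at this
        cases this
    constructor
    · exact fun i m hm => hmono m (h.received_subset i m hm)
    · intro m₁ h₁ m₂ h₂ e₁ e₂ e₃
      rcases List.mem_cons.1 h₁ with rfl | h₁'
      · rcases List.mem_cons.1 h₂ with rfl | h₂'
        · rfl
        · exact absurd ⟨e₁.symm, e₂.symm, e₃.symm⟩ (hnew m₂ h₂')
      · rcases List.mem_cons.1 h₂ with rfl | h₂'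
        · exact absurd ⟨e₁, e₂, e₃⟩ (hnew m₁ h₁')
        · exact h.unique m₁ h₁' m₂ h₂' e₁ e₂ e₃
    · intro m hm hc
      rcases List.mem_cons.1 hm with rfl | hm
      · refine .intro _ List.mem_cons_self (follows_finishSubstep hq) ?_
        intro m₁ hm₁
        rw [hr, just_finishSubstep, hM, mem_messageSet] at hm₁
        exact hm₁.1.mono fun m hm => hmono m (h.received_subset i m hm)
      · exact (h.valid m hm hc).mono hmono
    · intro j hj s' k'
      by_cases hij : j = i
      · subst hij
        simp only [Function.update_self]
        rw [hr, reached_finishSubstep, ← hr, ← hst, h.reached j hj]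
        constructor
        · rintro (⟨m, hm, e⟩ | e)
          · exact ⟨m, List.mem_cons_of_mem _ hm, e⟩
          · exact ⟨_, List.mem_cons_self, hri, e⟩
        · rintro ⟨m, hm, e⟩
          rcases List.mem_cons.1 hm with rfl | hm
          · exact Or.inr e.2
          · exact Or.inl ⟨m, hm, e⟩
      · simp only [Function.update_of_ne hij]
        refine (h.reached j hj s' k').trans ⟨?_, ?_⟩
        · rintro ⟨m₁, hm₁, e⟩
          exact ⟨m₁, hmono _ hm₁, e⟩
        · rintro ⟨m, hm, e⟩
          rcases List.mem_cons.1 hm with rfl | hm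
          · exact absurd (e.1.symm.trans hri) hij
          · exact ⟨m, hm, e⟩
    · intro j hj s' b
      by_cases hij : j = i
      · subst hij
        simp only [Function.update_self]
        rw [hr, finishSubstep_eq_decided, ← hr]
        constructor
        · intro e
          exact ⟨_, List.mem_cons_self, hri, e⟩
        · rintro ⟨m, hm, e⟩
          rcases List.mem_cons.1 hm with rfl | hm
          · exact e.2
          · have := (h.decided j hj s' b).2 ⟨m, hm, e⟩
            rw [hst] at this
            cases this
      · simp only [Function.update_of_ne hij]
        refine (h.decided j hj s' b).trans ⟨?_, ?_⟩
        · rintro ⟨m₁, hm₁, e⟩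
          exact ⟨m₁, hmono _ hm₁, e⟩
        · rintro ⟨m, hm, e⟩
          rcases List.mem_cons.1 hm with rfl | hm
          · exact absurd (e.1.symm.trans hri) hij
          · exact ⟨m, hm, e⟩
    · intro m hm hc hk hs
      rcases List.mem_cons.1 hm with rfl | hm
      · exact absurd hs (step_finishSubstep_ne_zero hk)
      · exact h.first_zero m hm hc hk hs
    · intro m hm hc hk s' hs
      rcases List.mem_cons.1 hm with rfl | hm
      · rw [hri, hr, value_finishSubstep_first hk hs, just_finishSubstep]
      · exact h.first_succ m hm hc hk s' hs

end Execution

open Filter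

/-! ### Executions -/

section Execution

variable {n t : ℕ} {corrupt : Finset (Fin n)} {input : Fin n → Bool} {adv : Adversary n}
  {coin coin' : ℕ → Flip → Fin n → Bool} {c : Config n} {i : Fin n} {k k' : ℕ}

local notation "conf" => config t corrupt input adv coin

theorem config_succ : conf (k + 1) =
    applyAction t corrupt coin (conf k) (action t corrupt input adv coin k) := rfl

theorem transition_config (k : ℕ) : Transition t corrupt coin (conf k) (conf (k + 1)) :=
  transition_applyAction _ _

theorem invariant_config (k : ℕ) : Invariant t corrupt input coin (conf k) := by
  induction k with
  | zero => exact invariant_startConfig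
  | succ k ih => exact ih.transition (transition_config k)

theorem sent_mono (h : k ≤ k') : ∀ m ∈ (conf k).sent, m ∈ (conf k').sent := by
  induction k', h using Nat.le_induction with
  | base => exact fun _ => id
  | succ k' _ ih => exact fun m hm => (transition_config k').sent_subset (ih m hm)

theorem received_mono (h : k ≤ k') :
    ∀ m ∈ (conf k).received i, m ∈ (conf k').received i := by
  induction k', h using Nat.le_induction with
  | base => exact fun _ => id
  | succ k' _ ih => exact fun m hm => (transition_config k').received_subset (ih m hm)

theorem position_mono (h : k ≤ k') : ((conf k).state i).position ≤ ((conf k').state i).position := by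
  induction k', h using Nat.le_induction with
  | base => exact le_rfl
  | succ k' _ ih => exact ih.trans ((transition_config k').position_le i)

theorem isDecided_mono (h : k ≤ k') (hd : ((conf k).state i).IsDecided) :
    ((conf k').state i).IsDecided := by
  induction k', h using Nat.le_induction with
  | base => exact hd
  | succ k' _ ih =>
    obtain ⟨s, b, h⟩ := ih
    exact ⟨s, b, (transition_config k').decided h⟩

/-- The messages that are valid at some time when everything that was broadcast is delivered. -/
def EverValid (t : ℕ) (corrupt : Finset (Fin n)) (input : Fin n → Bool) (adv : Adversary n)
    (coin : ℕ → Flip → Fin n → Bool) (m : Msg n) : Prop :=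
  ∃ k, Valid t (config t corrupt input adv coin k).sent m

local notation "ever" => EverValid t corrupt input adv coin

theorem justified_everValid : Justified t ever where
  follows := fun ⟨_, h⟩ => h.follows
  just := fun ⟨k, h⟩ m₁ hm₁ => ⟨k, h.just m₁ hm₁⟩
  unique := by
    rintro m₁ m₂ ⟨k₁, h₁⟩ ⟨k₂, h₂⟩
    exact (invariant_config (max k₁ k₂)).unique _ (sent_mono (le_max_left _ _) _ h₁.mem) _
      (sent_mono (le_max_right _ _) _ h₂.mem)

theorem EverValid.exists_mem {m : Msg n} (h : ever m) : ∃ k, m ∈ (conf k).sent :=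
  let ⟨k, h⟩ := h
  ⟨k, h.mem⟩

theorem everValid_of_honest {m : Msg n} (h : m ∈ (conf k).sent) (hm : m.sender ∉ corrupt) :
    ever m :=
  ⟨k, (invariant_config k).valid m h hm⟩

theorem DecidesAt.exists_decision {s : ℕ} {b : Bool} (hi : i ∉ corrupt)
    (h : DecidesAt t corrupt input adv coin i s b) :
    ∃ m, ever m ∧ m.step = s ∧ m.kind = Kind.decision ∧ m.value = some b := by
  obtain ⟨k, hk⟩ := h
  obtain ⟨m, hm, hs, h⟩ := ((invariant_config k).decided i hi s b).1 hk
  exact ⟨m, everValid_of_honest hm (hs ▸ hi), h⟩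

theorem Decides.agree (ht : 3 * t < n) {j : Fin n} {b c : Bool} (hi : i ∉ corrupt)
    (hj : j ∉ corrupt) (hb : Decides t corrupt input adv coin i b)
    (hc : Decides t corrupt input adv coin j c) : b = c := by
  obtain ⟨s, hs⟩ := hb
  obtain ⟨r, hr⟩ := hc
  obtain ⟨m₁, h₁, -, hk₁, hv₁⟩ := hs.exists_decision hi
  obtain ⟨m₂, h₂, -, hk₂, hv₂⟩ := hr.exists_decision hj
  exact justified_everValid.decision_agree ht h₁ h₂ hk₁ hk₂ hv₁ hv₂

theorem Decides.eq_input (ht : 3 * t < n) (hC : corrupt.card ≤ t) {b c : Bool}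
    (hin : ∀ i, i ∉ corrupt → input i = b) (hi : i ∉ corrupt)
    (hc : Decides t corrupt input adv coin i c) : c = b := by
  have hL : Locked ever 0 b := by
    refine .of_honest_first justified_everValid ht hC ?_ ?_
    · intro m hm hs hk hmC
      obtain ⟨k, hk'⟩ := hm.exists_mem
      rw [(invariant_config k).first_zero m hk' hmC hk hs, hin _ hmC]
    · intro m _ _ h
      exact absurd h (Nat.not_lt_zero _)
  obtain ⟨s, hs⟩ := hc
  obtain ⟨m, hm, -, hk, hv⟩ := hs.exists_decision hi
  have := (hL.mono justified_everValid ht (Nat.zero_le m.step)).decision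
    justified_everValid ht hm hk le_rfl
  rw [hv] at this
  exact Option.some.inj this

/-! ### Progress in fair executions -/

theorem eventually_received (hF : Fair t corrupt input adv coin) (hi : i ∉ corrupt) {m : Msg n}
    (hm : m ∈ (conf k).sent) : ∀ᶠ l in atTop, m ∈ (conf l).received i := by
  obtain ⟨l, hl⟩ := (hF i hi).1 k m hm
  exact eventually_atTop.2 ⟨l, fun l' h => received_mono h m hl⟩

theorem eventually_valid_received (hF : Fair t corrupt input adv coin) (hi : i ∉ corrupt)
    {m : Msg n} (hm : Valid t (conf k).sent m) :
    ∀ᶠ l in atTop, Valid t ((conf l).received i) m := by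
  induction hm with
  | intro m hm hf _ ih =>
    have h₁ : ∀ᶠ l in atTop, ∀ m₁ ∈ {m₁ | m₁ ∈ m.just}, Valid t ((conf l).received i) m₁ :=
      (eventually_all_finite m.just.finite_toSet).2 ih
    filter_upwards [h₁, eventually_received hF hi hm] with l h₁ h₂
    exact .intro m h₂ hf h₁

/-- An honest participant has only one message that counts for a given sub-step: it stops after
its decision. -/
theorem Invariant.eq_of_countsFor (h : Invariant t corrupt input coin c) {s : ℕ} {q : Substep}
    {m₁ m₂ : Msg n} (h₁ : m₁ ∈ c.sent) (h₂ : m₂ ∈ c.sent) (hs : m₁.sender = m₂.sender)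
    (hi : m₂.sender ∉ corrupt) (hc₁ : CountsFor s q m₁) (hc₂ : CountsFor s q m₂) : m₁ = m₂ := by
  have hdec : ∀ m ∈ c.sent, m.sender = m₂.sender → m.kind = Kind.decision →
      ∃ b, c.state m₂.sender = LocalState.decided m.step b := by
    intro m hm hms hk
    obtain ⟨b, hb, -⟩ := (h.valid m hm (hms ▸ hi)).follows.decision hk
    exact ⟨b, (h.decided _ hi _ b).2 ⟨m, hm, hms, rfl, hk, hb⟩⟩
  have hvote : ∀ m ∈ c.sent, m.sender = m₂.sender → m.kind = Kind.vote q → m.step = s →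
      Reached (c.state m₂.sender) s q := fun m hm hms hk hs =>
    (h.reached _ hi s q).2 ⟨m, hm, hms, hs, hk⟩
  rcases hc₁ with ⟨hs₁, hk₁⟩ | ⟨hk₁, hlt₁⟩ <;> rcases hc₂ with ⟨hs₂, hk₂⟩ | ⟨hk₂, hlt₂⟩
  · exact h.unique _ h₁ _ h₂ hs (hs₁.trans hs₂.symm) (hk₁.trans hk₂.symm)
  · obtain ⟨b, hb⟩ := hdec m₂ h₂ rfl hk₂
    have := hvote m₁ h₁ hs hk₁ hs₁
    rw [hb] at this
    exact absurd this (not_le.2 hlt₂)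
  · obtain ⟨b, hb⟩ := hdec m₁ h₁ hs hk₁
    have := hvote m₂ h₂ rfl hk₂ hs₂
    rw [hb] at this
    exact absurd this (not_le.2 hlt₁)
  · obtain ⟨b₁, hb₁⟩ := hdec m₁ h₁ hs hk₁
    obtain ⟨b₂, hb₂⟩ := hdec m₂ h₂ rfl hk₂
    rw [hb₁] at hb₂
    exact h.unique _ h₁ _ h₂ hs (LocalState.decided.inj hb₂).1 (hk₁.trans hk₂.symm)

/-- The messages of the honest participants suffice to finish waiting, since every equivocator is
an additional sender. -/
theorem Invariant.isQuorum (h : Invariant t corrupt input coin c) (hC : corrupt.card ≤ t)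
    {s : ℕ} {q : Substep}
    (hs : ∀ j, j ∉ corrupt → ∃ m ∈ messageSet t (c.received i) s q, m.sender = j) :
    IsQuorum t s q (messageSet t (c.received i) s q) := by
  set M := messageSet t (c.received i) s q with hM
  have hsent : ∀ m ∈ M, m ∈ c.sent ∧ CountsFor s q m := fun m hm =>
    have := mem_messageSet.1 hm
    ⟨h.received_subset i m this.1.mem, this.2⟩
  refine ⟨fun m hm => (hsent m hm).2, ?_⟩
  have hI : equivocators M ⊆ corrupt := by
    intro j hj
    by_contra hjc
    obtain ⟨m₁, h₁, m₂, h₂, e₁, e₂, hne⟩ := mem_equivocators.1 hj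
    exact hne (h.eq_of_countsFor (hsent m₁ h₁).1 (hsent m₂ h₂).1 (e₁.trans e₂.symm)
      (e₂ ▸ hjc) (hsent m₁ h₁).2 (hsent m₂ h₂).2)
  have hsub : corruptᶜ ∪ equivocators M ⊆ senders M := by
    refine Finset.union_subset (fun j hj => ?_) equivocators_subset_senders
    exact mem_senders.2 (hs j (Finset.mem_compl.1 hj))
  have hcard := Finset.card_le_card hsub
  rw [Finset.card_union_of_disjoint, Finset.card_compl, Fintype.card_fin] at hcard
  · omega
  · exact Finset.disjoint_left.2 fun j hj hj' => Finset.mem_compl.1 hj (hI hj')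

/-- In a fair execution no honest participant waits forever: if all of them have finished `p`
sub-steps or decided, then their messages eventually let each of them finish the next one. -/
theorem eventually_position_ge (hC : corrupt.card ≤ t) (hF : Fair t corrupt input adv coin)
    (p : ℕ) : ∀ i, i ∉ corrupt →
      ∀ᶠ l in atTop, ((conf l).state i).IsDecided ∨ p ≤ ((conf l).state i).position := by
  induction p with
  | zero => exact fun i _ => Eventually.of_forall fun l => Or.inr (Nat.zero_le _)
  | succ p ih =>
    intro i hi
    have hlater : ∀ l, (((conf l).state i).IsDecided ∨
        p + 1 ≤ ((conf l).state i).position) →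
        ∀ᶠ l in atTop, ((conf l).state i).IsDecided ∨ p + 1 ≤ ((conf l).state i).position :=
      fun l h => eventually_atTop.2 ⟨l, fun l' hl => h.imp (isDecided_mono hl)
        fun h => h.trans (position_mono hl)⟩
    have hall : ∀ᶠ l in atTop, ∀ j, j ∉ corrupt →
        ((conf l).state j).IsDecided ∨ p ≤ ((conf l).state j).position :=
      eventually_all.2 fun j => by
        by_cases hj : j ∈ corrupt
        · exact Eventually.of_forall fun l h => absurd hj h
        · filter_upwards [ih j hj] with l hl _ using hl
    obtain ⟨l, hl⟩ := hall.exists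
    by_cases hdone : ((conf l).state i).IsDecided ∨ p + 1 ≤ ((conf l).state i).position
    · exact hlater l hdone
    push Not at hdone
    have hpos : ((conf l).state i).position = p := by
      have := (hl i hi).resolve_left hdone.1
      omega
    rcases hst : (conf l).state i with ⟨s, q⟩ | ⟨s, b⟩
    swap
    · exact absurd ⟨s, b, hst⟩ hdone.1
    rw [hst] at hpos
    have hmsg : ∀ j, j ∉ corrupt → ∃ m ∈ (conf l).sent, m.sender = j ∧ CountsFor s q m := by
      intro j hj
      have hvote : Reached ((conf l).state j) s q →
          ∃ m ∈ (conf l).sent, m.sender = j ∧ CountsFor s q m := fun h =>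
        let ⟨m, hm, h₁, h₂, h₃⟩ := ((invariant_config l).reached j hj s q).1 h
        ⟨m, hm, h₁, Or.inl ⟨h₂, h₃⟩⟩
      rcases hd : (conf l).state j with ⟨s', q'⟩ | ⟨s', b⟩
      · refine hvote ?_
        have hp := hl j hj
        rw [hd] at hp ⊢
        rcases hp with ⟨_, _, h⟩ | hp
        · cases h
        · exact hpos.le.trans hp
      · rcases le_or_gt s s' with hle | hlt
        · exact hvote (by rw [hd]; exact hle)
        · obtain ⟨m, hm, h₁, rfl, h₃, -⟩ := ((invariant_config l).decided j hj s' b).1 hd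
          exact ⟨m, hm, h₁, .of_lt h₃ hlt⟩
    have hready : ∀ᶠ l' in atTop, ∀ j, j ∉ corrupt →
        ∃ m ∈ messageSet t ((conf l').received i) s q, m.sender = j :=
      eventually_all.2 fun j => by
        by_cases hj : j ∈ corrupt
        · exact Eventually.of_forall fun l h => absurd hj h
        · obtain ⟨m, hm, h₁, h₂⟩ := hmsg j hj
          filter_upwards [eventually_valid_received hF hi
            ((invariant_config l).valid m hm (h₁ ▸ hj))] with l' hl' _
          exact ⟨m, mem_messageSet.2 ⟨hl', h₂⟩, h₁⟩
    obtain ⟨l₁, hl₁⟩ := eventually_atTop.1 hready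
    obtain ⟨l₂, hl₂, hact⟩ := (hF i hi).2 (max l l₁)
    by_cases hdone₂ : ((conf l₂).state i).IsDecided ∨ p + 1 ≤ ((conf l₂).state i).position
    · exact hlater l₂ hdone₂
    push Not at hdone₂
    have hpos₂ := position_mono (t := t) (corrupt := corrupt) (input := input) (adv := adv)
      (coin := coin) (i := i) ((le_max_left _ _).trans hl₂)
    rw [hst, hpos] at hpos₂
    have hst₂ : (conf l₂).state i = waiting s q := by
      rcases hst₂ : (conf l₂).state i with ⟨s', q'⟩ | ⟨s', b⟩
      · rw [hst₂] at hdone₂ hpos₂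
        have h₁ : 3 * s + q.index = p := hpos
        have h₂ : p ≤ 3 * s' + q'.index := hpos₂
        have h₃ : 3 * s' + q'.index < p + 1 := hdone₂.2
        have h₄ := q.index_lt
        have h₅ := q'.index_lt
        obtain rfl : s' = s := by omega
        obtain rfl : q' = q := Substep.index_injective (by omega)
        rfl
      · exact absurd ⟨s', b, hst₂⟩ hdone₂.1
    have hquo := (invariant_config l₂).isQuorum (i := i) hC (hl₁ l₂ ((le_max_right _ _).trans hl₂))
    refine hlater (l₂ + 1) (Or.inr ?_)
    rw [config_succ, hact]
    simp only [applyAction, hi, if_false, hst₂, hquo, if_true, Function.update_self]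
    rw [position_finishSubstep, hpos]

/-- If no honest participant enters step `S + 1` of a fair execution, then all of them decide. -/
theorem decidesAt_of_no_first (hC : corrupt.card ≤ t) (hF : Fair t corrupt input adv coin)
    {S : ℕ} (hS : ∀ m, ever m → m.sender ∉ corrupt → m.kind = Kind.vote Substep.first →
      m.step ≠ S + 1) (hi : i ∉ corrupt) :
    ∃ s b, s ≤ S ∧ DecidesAt t corrupt input adv coin i s b := by
  obtain ⟨l, hl⟩ := (eventually_position_ge hC hF (3 * (S + 1)) i hi).exists
  have hno : ¬ Reached ((conf l).state i) (S + 1) Substep.first := by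
    intro h
    obtain ⟨m, hm, hs, h₁, h₂⟩ := ((invariant_config l).reached i hi _ _).1 h
    exact hS m (everValid_of_honest hm (hs ▸ hi)) (hs ▸ hi) h₂ h₁
  rcases hst : (conf l).state i with ⟨s, q⟩ | ⟨s, b⟩
  · rw [hst] at hl hno
    rcases hl with ⟨s', b, h⟩ | hl
    · cases h
    · exact absurd hl hno
  · rw [hst] at hno
    have hno' : ¬ S + 1 ≤ s := hno
    exact ⟨s, b, by omega, l, hst⟩

theorem Decides.of_fair (ht : 3 * t < n) (hC : corrupt.card ≤ t)
    (hF : Fair t corrupt input adv coin) {j : Fin n} {b : Bool} (hi : i ∉ corrupt)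
    (hj : j ∉ corrupt) (hb : Decides t corrupt input adv coin i b) :
    Decides t corrupt input adv coin j b := by
  obtain ⟨s, hs⟩ := id hb
  obtain ⟨m, hm, -, hk, hv⟩ := hs.exists_decision hi
  have hL := justified_everValid.locked_of_decision ht hm hk hv
  obtain ⟨r, c, -, hr⟩ := decidesAt_of_no_first hC hF
    (fun m' hm' _ hk' hs' => hL.no_first justified_everValid ht hm' hk' hs') hj
  have hc : Decides t corrupt input adv coin j c := ⟨r, hr⟩
  rwa [hb.agree ht hi hj hc]

end Execution

/-! ### What an execution knows about the coins -/

section Coins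

variable {n t : ℕ} {corrupt : Finset (Fin n)} {input : Fin n → Bool} {adv : Adversary n}
  {coin coin' : ℕ → Flip → Fin n → Bool} {c : Config n} {i : Fin n} {k k' s : ℕ}

local notation "conf" => config t corrupt input adv coin
local notation "ever" => EverValid t corrupt input adv coin

/-- No participant has gone beyond step `s`. -/
def Quiet (s : ℕ) (c : Config n) : Prop := ∀ i, (c.state i).step ≤ s

/-- The two coin outcomes agree on all flips before the flips at the end of step `s`. -/
def AgreeBefore (s : ℕ) (coin coin' : ℕ → Flip → Fin n → Bool) : Prop :=
  ∀ r f i, r < s ∨ (r = s ∧ f = Flip.tie) → coin r f i = coin' r f i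

theorem AgreeBefore.symm (h : AgreeBefore s coin coin') : AgreeBefore s coin' coin :=
  fun r f i hr => (h r f i hr).symm

theorem quiet_of_succ (h : Quiet s (conf (k + 1))) : Quiet s (conf k) :=
  fun i => ((transition_config k).step_le i).trans (h i)

theorem quiet_config_self (k : ℕ) : Quiet k (conf k) := by
  induction k with
  | zero => exact fun _ => le_rfl
  | succ k ih =>
    exact fun i => ((transition_config k).step_le_succ i).trans (Nat.succ_le_succ (ih i))

theorem applyAction_congr {a : Action n} (h : AgreeBefore s coin coin') (hc : Quiet s c)
    (hc' : Quiet s (applyAction t corrupt coin c a)) :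
    applyAction t corrupt coin c a = applyAction t corrupt coin' c a := by
  rcases a with m | ⟨i, m⟩ | i
  · rfl
  · rfl
  · have hi' := hc' i
    have hi := hc i
    simp only [applyAction] at hi' ⊢
    split_ifs with hic
    · rfl
    · rw [if_neg hic] at hi'
      rcases hst : c.state i with ⟨s', q⟩ | ⟨s', b⟩
      · simp only [hst] at hi' ⊢
        rw [hst] at hi
        split_ifs with hq
        · rw [if_pos hq] at hi'
          simp only [Function.update_self] at hi'
          have hs' : s' ≤ s := hi
          rw [finishSubstep_congr (coin' := coin') (h s' _ _ (by
              rcases hs'.lt_or_eq with h | h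
              · exact Or.inl h
              · exact Or.inr ⟨h, rfl⟩))
            (fun hlt => h s' _ _ (Or.inl (hlt.trans_le hi')))]
        · rfl
      · rfl

/-- As long as nobody has gone beyond step `s`, the execution does not depend on the coins flipped
at the end of step `s` or later. -/
theorem trace_congr (h : AgreeBefore s coin coin') (hq : Quiet s (conf k)) :
    trace t corrupt input adv coin k = trace t corrupt input adv coin' k := by
  induction k with
  | zero => rfl
  | succ k ih =>
    have hk := quiet_of_succ hq
    have e := ih hk
    have := applyAction_congr (a := action t corrupt input adv coin k) h hk hq
    simp only [trace]
    rw [← e]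
    exact Prod.ext this rfl

open scoped Classical in
/-- The value favoured in step `s`: `true` if, before anybody went beyond step `s`, there was a
valid message with value `true` that counts for its third sub-step, and `false` otherwise. -/
noncomputable def favoured (t : ℕ) (corrupt : Finset (Fin n)) (input : Fin n → Bool)
    (adv : Adversary n) (s : ℕ) (coin : ℕ → Flip → Fin n → Bool) : Bool :=
  decide (∃ k, Quiet s (config t corrupt input adv coin k) ∧
    ∃ m, Valid t (config t corrupt input adv coin k).sent m ∧ CountsFor s Substep.third m ∧
      m.value = some true)

/-- The favoured value of a step is determined before the coins at the end of the step are
flipped. -/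
theorem favoured_congr (h : AgreeBefore s coin coin') :
    favoured t corrupt input adv s coin = favoured t corrupt input adv s coin' := by
  have key : ∀ {coin coin' : ℕ → Flip → Fin n → Bool}, AgreeBefore s coin coin' →
      (∃ k, Quiet s (config t corrupt input adv coin k) ∧
        ∃ m, Valid t (config t corrupt input adv coin k).sent m ∧ CountsFor s Substep.third m ∧
          m.value = some true) →
      ∃ k, Quiet s (config t corrupt input adv coin' k) ∧
        ∃ m, Valid t (config t corrupt input adv coin' k).sent m ∧
          CountsFor s Substep.third m ∧ m.value = some true := by
    rintro coin coin' h ⟨k, hk, hm⟩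
    have e : config t corrupt input adv coin k = config t corrupt input adv coin' k :=
      congrArg Prod.fst (trace_congr h hk)
    exact ⟨k, e ▸ hk, e ▸ hm⟩
  unfold favoured
  exact decide_eq_decide.2 ⟨key h, key h.symm⟩

theorem Transition.exists_quorum {c' : Config n} (h : Transition t corrupt coin c c')
    (hc : Quiet s c) (hc' : ¬ Quiet s c') :
    ∃ i, IsQuorum t s Substep.third (messageSet t (c.received i) s Substep.third) := by
  cases h with
  | stay => exact absurd hc hc'
  | broadcast => exact absurd hc hc'
  | deliver => exact absurd hc hc'
  | finish i r q hi hst hq =>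
    refine ⟨i, ?_⟩
    have hr := hc i
    rw [hst] at hr
    have hlt : s < (finishSubstep t coin i r q (messageSet t (c.received i) r q)).1.step := by
      by_contra hle
      refine hc' fun j => ?_
      by_cases hij : j = i
      · subst hij
        simpa only [Function.update_self] using not_lt.1 hle
      · simpa only [Function.update_of_ne hij] using hc j
    have h₁ := hlt.trans_le step_finishSubstep_le
    obtain rfl : r = s := le_antisymm hr (Nat.lt_succ_iff.1 h₁)
    obtain rfl := eq_third_of_lt_step hlt
    exact hq

/-- When the first participant leaves step `s`, it has seen enough third votes to fix the only
value that can still be adopted without a coin, or to exclude that there is one. -/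
theorem locked_of_coin_eq_favoured (ht : 3 * t < n) (hC : corrupt.card ≤ t)
    (hcoin : ∀ i, i ∉ corrupt → coin s Flip.final i = favoured t corrupt input adv s coin)
    (hk : ¬ Quiet s (conf k)) :
    Locked ever (s + 1) (favoured t corrupt input adv s coin) := by
  classical
  have hex : ∃ k, ¬ Quiet s (conf k) := ⟨k, hk⟩
  obtain ⟨l, hl⟩ : ∃ l, Nat.find hex = l + 1 := Nat.exists_eq_succ_of_ne_zero fun h =>
    Nat.find_spec hex (by rw [h]; exact fun _ => Nat.zero_le s)
  have hl₁ : ¬ Quiet s (conf (l + 1)) := hl ▸ Nat.find_spec hex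
  have hl₀ : Quiet s (conf l) := not_not.1 (Nat.find_min hex (hl ▸ Nat.lt_succ_self l))
  obtain ⟨i, hq⟩ := (transition_config l).exists_quorum hl₀ hl₁
  have hM : ∀ m ∈ messageSet t ((conf l).received i) s Substep.third,
      Valid t (conf l).sent m ∧ CountsFor s Substep.third m := fun m hm =>
    have := mem_messageSet.1 hm
    ⟨this.1.mono ((invariant_config l).received_subset i), this.2⟩
  refine justified_everValid.locked_of_coin ht hC (fun m hm => ⟨l, (hM m hm).1⟩) hq ?_ ?_
  · rcases hb : favoured t corrupt input adv s coin with _ | _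
    · refine Or.inr fun m hm hv => ?_
      exact of_decide_eq_false hb ⟨l, hl₀, m, (hM m hm).1, (hM m hm).2, hv⟩
    · obtain ⟨k, -, m, hm, hc, hv⟩ := of_decide_eq_true hb
      exact Or.inl ⟨m, ⟨k, hm⟩, hc, hv⟩
  · intro m hm hs hkind hmC
    obtain ⟨k, hk⟩ := hm.exists_mem
    rw [(invariant_config k).first_succ m hk hmC hkind s hs, hcoin _ hmC]

/-- If in step `s` all honest participants are dealt the favoured value, then they decide in the
next step at the latest. -/
theorem decidesAt_of_coin_eq_favoured (ht : 3 * t < n) (hC : corrupt.card ≤ t)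
    (hF : Fair t corrupt input adv coin)
    (hcoin : ∀ i, i ∉ corrupt → coin s Flip.final i = favoured t corrupt input adv s coin) :
    ∀ i, i ∉ corrupt → ∃ r b, r ≤ s + 1 ∧ DecidesAt t corrupt input adv coin i r b := by
  intro i hi
  refine decidesAt_of_no_first hC hF ?_ hi
  intro m hm hmC hk hs
  by_cases hq : ∃ k, ¬ Quiet s (conf k)
  · obtain ⟨k, hq⟩ := hq
    exact (locked_of_coin_eq_favoured ht hC hcoin hq).no_first justified_everValid ht hm hk hs
  · push Not at hq
    obtain ⟨k, hmk⟩ := hm.exists_mem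
    have hr := ((invariant_config k).reached _ hmC (s + 1 + 1) Substep.first).2
      ⟨m, hmk, rfl, hs, hk⟩
    have hle := hq k m.sender
    rcases hst : (conf k).state m.sender with ⟨s', q⟩ | ⟨s', b⟩ <;> rw [hst] at hr hle
    · have h₁ : 3 * (s + 1 + 1) + 0 ≤ 3 * s' + q.index := hr
      have h₂ : s' ≤ s := hle
      have := q.index_lt
      omega
    · have h₁ : s + 1 + 1 ≤ s' := hr
      have h₂ : s' ≤ s := hle
      omega

theorem stepsToDecide_le {S : ℕ}
    (h : ∀ i, i ∉ corrupt → ∃ s b, s ≤ S ∧ DecidesAt t corrupt input adv coin i s b) :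
    stepsToDecide t corrupt input adv coin ≤ (S : ℝ≥0∞) + 1 :=
  iInf_le (fun S : {S : ℕ // ∀ i, i ∉ corrupt →
    ∃ s b, s ≤ S ∧ DecidesAt t corrupt input adv coin i s b} => ((S.1 : ℝ≥0∞) + 1)) ⟨S, h⟩

end Coins

open ProbabilityTheory

/-! ### Independent fair coins -/

section FairCoins

variable {ι : Type} {p q : (ι → Bool) → Prop} {I J : Finset ι}

theorem setOf_eq_preimage_restrict (hp : DependsOn p I) :
    {ω | p ω} = I.restrict ⁻¹' (I.restrict '' {ω | p ω}) := by
  refine (Set.subset_preimage_image _ _).antisymm ?_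
  rintro ω ⟨ω', h, e⟩
  have : p ω' = p ω := hp fun x hx => congrFun e ⟨x, hx⟩
  exact this.mp h

theorem measurableSet_of_dependsOn (hp : DependsOn p I) : MeasurableSet {ω | p ω} := by
  rw [setOf_eq_preimage_restrict hp]
  exact I.measurable_restrict (Set.toFinite _).measurableSet

instance : IsProbabilityMeasure (fairCoins ι) := by
  unfold fairCoins
  infer_instance

theorem fairCoins_inter (hp : DependsOn p I) (hq : DependsOn q J) (h : Disjoint I J) :
    fairCoins ι ({ω | p ω} ∩ {ω | q ω}) = fairCoins ι {ω | p ω} * fairCoins ι {ω | q ω} := by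
  have hind : iIndepFun (fun x (ω : ι → Bool) => ω x) (fairCoins ι) :=
    iIndepFun_infinitePi (P := fun _ : ι => (PMF.uniformOfFintype Bool).toMeasure)
      (X := fun _ b => b) fun _ => measurable_id
  have hIJ := hind.indepFun_finset I J h fun x => measurable_pi_apply x
  rw [setOf_eq_preimage_restrict hp, setOf_eq_preimage_restrict hq]
  exact hIJ.measure_inter_preimage_eq_mul _ _ (Set.toFinite _).measurableSet
    (Set.toFinite _).measurableSet

theorem fairCoins_forall_eq (J : Finset ι) (c : Bool) :
    fairCoins ι {ω | ∀ x ∈ J, ω x = c} = (2 ^ J.card)⁻¹ := by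
  have h := Measure.infinitePi_pi (fun _ : ι => (PMF.uniformOfFintype Bool).toMeasure) (s := J)
    (t := fun _ => {c}) fun _ _ => measurableSet_singleton c
  have e : {ω : ι → Bool | ∀ x ∈ J, ω x = c} = Set.pi J fun _ => {c} := by
    ext ω
    simp [Set.mem_pi]
  rw [e]
  refine h.trans ?_
  rw [Finset.prod_const, PMF.toMeasure_apply_singleton _ _ (measurableSet_singleton c)]
  simp [ENNReal.inv_pow]

theorem dependsOn_miss {A B : ℕ → Finset ι} {b : ℕ → (ι → Bool) → Bool}
    (hA : ∀ r s, r < s → A r ⊆ A s) (hBA : ∀ r s, r < s → B r ⊆ A s)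
    (hb : ∀ s, DependsOn (b s) (A s : Set ι)) (s : ℕ) :
    DependsOn (fun ω : ι → Bool => ∀ r < s, ∃ x ∈ B r, ω x ≠ b r ω) (A s) := by
  intro ω ω' h
  refine forall_congr fun r => forall_congr fun hr => ?_
  rw [hb r fun x hx => h x (hA r s hr hx)]
  refine propext (exists_congr fun x => and_congr_right fun hx => ?_)
  rw [h x (hBA r s hr hx)]

/-- A sequence of guesses. The coins of block `B s` have to agree with the bit `b s`, which is
determined by the coins `A s` of earlier blocks. The probability that the first `s` blocks all
fail decays geometrically. -/
theorem fairCoins_miss_le {A B : ℕ → Finset ι} {b : ℕ → (ι → Bool) → Bool} {d : ℕ}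
    (hAB : ∀ s, Disjoint (A s) (B s)) (hA : ∀ r s, r < s → A r ⊆ A s)
    (hBA : ∀ r s, r < s → B r ⊆ A s) (hB : ∀ s, (B s).card ≤ d)
    (hb : ∀ s, DependsOn (b s) (A s : Set ι)) (s : ℕ) :
    fairCoins ι {ω | ∀ r < s, ∃ x ∈ B r, ω x ≠ b r ω} ≤ (1 - (2 ^ d)⁻¹) ^ s := by
  induction s with
  | zero => simp
  | succ s ih =>
    set N : (ι → Bool) → Prop := fun ω => ∀ r < s, ∃ x ∈ B r, ω x ≠ b r ω with hN
    have hNA : DependsOn N (A s) := dependsOn_miss hA hBA hb s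
    have hNc : ∀ c, DependsOn (fun ω => N ω ∧ b s ω = c) (A s) := by
      intro c ω ω' h
      simp only [hNA h, hb s h]
    have hQ : ∀ c : Bool, DependsOn (fun ω : ι → Bool => ¬ ∀ x ∈ B s, ω x = c) (B s) := by
      intro c ω ω' h
      refine congrArg Not (forall_congr fun x => forall_congr fun hx => ?_)
      rw [h x hx]
    have hμQ : ∀ c : Bool,
        fairCoins ι {ω | ¬ ∀ x ∈ B s, ω x = c} ≤ 1 - (2 ^ d)⁻¹ := by
      intro c
      have hm : MeasurableSet {ω : ι → Bool | ∀ x ∈ B s, ω x = c} := by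
        have := (measurableSet_of_dependsOn (hQ c)).compl
        simpa only [Set.compl_ofPred, not_not] using this
      have e := prob_compl_eq_one_sub (μ := fairCoins ι) hm
      rw [fairCoins_forall_eq, Set.compl_ofPred] at e
      rw [e]
      refine tsub_le_tsub_left (ENNReal.inv_le_inv.2 ?_) 1
      exact pow_le_pow_right₀ one_le_two (hB s)
    have hsub : {ω | ∀ r < s + 1, ∃ x ∈ B r, ω x ≠ b r ω} ⊆
        ⋃ c : Bool, {ω | N ω ∧ b s ω = c} ∩ {ω | ¬ ∀ x ∈ B s, ω x = c} := by
      intro ω hω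
      refine Set.mem_iUnion.2 ⟨b s ω, ⟨fun r hr => hω r (hr.trans (Nat.lt_succ_self s)), rfl⟩, ?_⟩
      obtain ⟨x, hx, hne⟩ := hω s (Nat.lt_succ_self s)
      exact fun h => hne (h x hx)
    calc fairCoins ι {ω | ∀ r < s + 1, ∃ x ∈ B r, ω x ≠ b r ω}
        ≤ ∑' c : Bool, fairCoins ι ({ω | N ω ∧ b s ω = c} ∩ {ω | ¬ ∀ x ∈ B s, ω x = c}) :=
          (measure_mono hsub).trans (measure_iUnion_le _)
      _ ≤ ∑' c : Bool, fairCoins ι {ω | N ω ∧ b s ω = c} * (1 - (2 ^ d)⁻¹) := by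
          refine ENNReal.tsum_le_tsum fun c => ?_
          rw [fairCoins_inter (hNc c) (hQ c) (hAB s)]
          gcongr
          exact hμQ c
      _ = fairCoins ι {ω | N ω} * (1 - (2 ^ d)⁻¹) := by
          rw [ENNReal.tsum_mul_right, ← measure_iUnion]
          · congr 2
            ext ω
            simp
          · intro c c' hne
            refine Set.disjoint_left.2 fun ω h h' => hne ?_
            exact h.2.symm.trans h'.2
          · exact fun c => measurableSet_of_dependsOn (hNc c)
      _ ≤ (1 - (2 ^ d)⁻¹) ^ (s + 1) := by
          rw [pow_succ]
          gcongr

/-- The expected waiting time for a successful guess among independent blocks of at most `d`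
coins, where success in block `s` bounds `T` by `s + 2`. -/
theorem lintegral_le_of_guess {A B : ℕ → Finset ι} {b : ℕ → (ι → Bool) → Bool} {d : ℕ}
    (hAB : ∀ s, Disjoint (A s) (B s)) (hA : ∀ r s, r < s → A r ⊆ A s)
    (hBA : ∀ r s, r < s → B r ⊆ A s) (hB : ∀ s, (B s).card ≤ d)
    (hb : ∀ s, DependsOn (b s) (A s : Set ι)) {T : (ι → Bool) → ℝ≥0∞}
    (hT : ∀ᵐ ω ∂fairCoins ι, ∀ s : ℕ, (∀ x ∈ B s, ω x = b s ω) → T ω ≤ (s : ℝ≥0∞) + 2) :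
    ∫⁻ ω, T ω ∂fairCoins ι ≤ 1 + 2 ^ d := by
  classical
  set N : ℕ → Set (ι → Bool) := fun s => {ω | ∀ r < s, ∃ x ∈ B r, ω x ≠ b r ω} with hN
  have hNm : ∀ s, MeasurableSet (N s) := fun s =>
    measurableSet_of_dependsOn (dependsOn_miss hA hBA hb s)
  have hle : ∀ᵐ ω ∂fairCoins ι, T ω ≤ 1 + ∑' s, (N s).indicator 1 ω := by
    filter_upwards [hT] with ω hω
    by_cases hex : ∃ s, ∀ x ∈ B s, ω x = b s ω
    · refine (hω _ (Nat.find_spec hex)).trans ?_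
      -- Blocks `0, …, s - 1` fail, where `s` is the first success, so that `s + 1` of the
      -- indicators are `1`.
      have h₁ : ∑ s ∈ Finset.range (Nat.find hex + 1), (N s).indicator (1 : (ι → Bool) → ℝ≥0∞) ω =
          (Nat.find hex : ℝ≥0∞) + 1 := by
        rw [Finset.sum_congr rfl (g := fun _ => (1 : ℝ≥0∞))]
        · simp
        · intro s hs
          refine Set.indicator_of_mem (f := (1 : (ι → Bool) → ℝ≥0∞)) ?_
          intro r hr
          have := Nat.find_min hex (m := r) (by have := Finset.mem_range.1 hs; omega)
          push Not at this
          exact this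
      calc (Nat.find hex : ℝ≥0∞) + 2 = 1 + ((Nat.find hex : ℝ≥0∞) + 1) := by ring
        _ ≤ _ := by
          rw [← h₁]
          gcongr
          exact ENNReal.sum_le_tsum _
    · have h₁ : ∀ s, (N s).indicator (1 : (ι → Bool) → ℝ≥0∞) ω = 1 := by
        intro s
        refine Set.indicator_of_mem (f := (1 : (ι → Bool) → ℝ≥0∞)) ?_
        intro r hr
        push Not at hex
        exact hex r
      simp [h₁]
  calc ∫⁻ ω, T ω ∂fairCoins ι ≤ ∫⁻ ω, 1 + ∑' s, (N s).indicator 1 ω ∂fairCoins ι :=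
        lintegral_mono_ae hle
    _ = 1 + ∑' s, fairCoins ι (N s) := by
        rw [lintegral_add_left measurable_const, lintegral_tsum]
        · simp [hNm]
        · exact fun s => (measurable_one.indicator (hNm s)).aemeasurable
    _ ≤ 1 + ∑' s, (1 - (2 ^ d)⁻¹ : ℝ≥0∞) ^ s := by
        gcongr with s
        exact fairCoins_miss_le hAB hA hBA hB hb s
    _ = 1 + 2 ^ d := by
        rw [ENNReal.tsum_geometric, ENNReal.sub_sub_cancel ENNReal.one_ne_top, inv_inv]
        exact ENNReal.inv_le_one.2 (one_le_pow₀ one_le_two)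

end FairCoins

/-! ### Liveness -/

section Liveness

variable {n t : ℕ} {corrupt : Finset (Fin n)} {input : Fin n → Bool} {adv : Adversary n}
  {ι : Type}

instance : Finite Flip :=
  Finite.of_injective (fun f => match f with | Flip.tie => true | Flip.final => false) (by
    intro f f' h
    cases f <;> cases f' <;> first | rfl | cases h)

/-- The coins flipped before the flips at the end of step `s`, where the flip `f` of participant
`i` in step `r` uses the coin `idx r f i`. -/
def coinsBefore (idx : ℕ → Flip → Fin n → ι) (s : ℕ) : Set ι :=
  (fun x : ℕ × Flip × Fin n => idx x.1 x.2.1 x.2.2) ''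
    {x | x.1 < s ∨ (x.1 = s ∧ x.2.1 = Flip.tie)}

theorem finite_coinsBefore (idx : ℕ → Flip → Fin n → ι) (s : ℕ) : (coinsBefore idx s).Finite := by
  refine Set.Finite.image _ (((Set.finite_Iic s).prod (Set.finite_univ)).subset ?_)
  rintro ⟨r, f, i⟩ h
  refine ⟨?_, trivial⟩
  rcases h with h | h
  · exact Nat.le_of_lt h
  · exact le_of_eq h.1

theorem agreeBefore_of_forall_mem {idx : ℕ → Flip → Fin n → ι} {s : ℕ} {ω ω' : ι → Bool}
    (h : ∀ x ∈ coinsBefore idx s, ω x = ω' x) :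
    AgreeBefore s (fun r f i => ω (idx r f i)) (fun r f i => ω' (idx r f i)) :=
  fun r f i hr => h _ ⟨(r, f, i), hr, rfl⟩

theorem measurable_stepsToDecide (idx : ℕ → Flip → Fin n → ι) :
    Measurable fun ω : ι → Bool =>
      stepsToDecide t corrupt input adv fun r f i => ω (idx r f i) := by
  classical
  have hD : ∀ i s b, MeasurableSet {ω : ι → Bool |
      DecidesAt t corrupt input adv (fun r f i => ω (idx r f i)) i s b} := by
    intro i s b
    have : {ω : ι → Bool | DecidesAt t corrupt input adv (fun r f i => ω (idx r f i)) i s b} =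
        ⋃ k, {ω | (config t corrupt input adv (fun r f i => ω (idx r f i)) k).state i =
          LocalState.decided s b} := by
      ext ω
      simp [DecidesAt]
    rw [this]
    refine MeasurableSet.iUnion fun k => ?_
    refine measurableSet_of_dependsOn (I := (finite_coinsBefore idx k).toFinset) ?_
    intro ω ω' h
    rw [Set.Finite.coe_toFinset] at h
    have e := trace_congr (t := t) (corrupt := corrupt) (input := input) (adv := adv)
      (agreeBefore_of_forall_mem h) (quiet_config_self k)
    simp only [config, e]
  have hS : ∀ S : ℕ, MeasurableSet {ω : ι → Bool | ∀ i, i ∉ corrupt → ∃ s b, s ≤ S ∧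
      DecidesAt t corrupt input adv (fun r f i => ω (idx r f i)) i s b} := by
    intro S
    simp only [Set.ofPred_forall, Set.ofPred_exists, Set.ofPred_and]
    exact MeasurableSet.iInter fun i => MeasurableSet.iInter fun _ => MeasurableSet.iUnion fun s =>
      MeasurableSet.iUnion fun b => (MeasurableSet.const _).inter (hD i s b)
  have e : (fun ω : ι → Bool => stepsToDecide t corrupt input adv fun r f i => ω (idx r f i)) =
      fun ω => ⨅ S : ℕ, if ∀ i, i ∉ corrupt → ∃ s b, s ≤ S ∧
        DecidesAt t corrupt input adv (fun r f i => ω (idx r f i)) i s b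
        then (S : ℝ≥0∞) + 1 else ⊤ := by
    funext ω
    simp only [stepsToDecide, iInf_subtype, iInf_eq_if]
  rw [e]
  exact Measurable.iInf fun S => Measurable.ite (hS S) measurable_const measurable_const

/-- Liveness when the participants read at most `d` coins at the end of each step: all of these
coins show the favoured value with probability at least `2 ^ (-d)`, independently of the past. -/
theorem liveness (ht : 3 * t < n) (hC : corrupt.card ≤ t) (idx : ℕ → Flip → Fin n → ι)
    (hidx : ∀ r f i r' f' i', idx r f i = idx r' f' i' → r = r' ∧ f = f') {d : ℕ}
    (hd : ∀ s, (Set.range (idx s Flip.final)).ncard ≤ d)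
    (hF : ∀ᵐ ω ∂fairCoins ι, Fair t corrupt input adv fun r f i => ω (idx r f i)) :
    (∀ᵐ ω ∂fairCoins ι, ∀ i, i ∉ corrupt →
      ∃ b, Decides t corrupt input adv (fun r f i => ω (idx r f i)) i b) ∧
    Measurable (fun ω : ι → Bool =>
      stepsToDecide t corrupt input adv fun r f i => ω (idx r f i)) ∧
    ∫⁻ ω, stepsToDecide t corrupt input adv (fun r f i => ω (idx r f i)) ∂fairCoins ι
      ≤ 1 + 2 ^ d := by
  have hm := measurable_stepsToDecide (t := t) (corrupt := corrupt) (input := input) (adv := adv)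
    idx
  have hint : ∫⁻ ω, stepsToDecide t corrupt input adv (fun r f i => ω (idx r f i)) ∂fairCoins ι
      ≤ 1 + 2 ^ d := by
    refine lintegral_le_of_guess (A := fun s => (finite_coinsBefore idx s).toFinset)
      (B := fun s => (Set.finite_range (idx s Flip.final)).toFinset)
      (b := fun s ω => favoured t corrupt input adv s fun r f i => ω (idx r f i)) ?_ ?_ ?_ ?_ ?_ ?_
    · intro s
      rw [Set.Finite.disjoint_toFinset, Set.disjoint_left]
      rintro - ⟨⟨r, f, i⟩, hr, rfl⟩ ⟨j, hj⟩
      obtain ⟨rfl, rfl⟩ := hidx _ _ _ _ _ _ hj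
      rcases hr with h | ⟨-, h⟩
      · exact lt_irrefl _ h
      · cases h
    · intro r s hrs
      rw [Set.Finite.toFinset_subset_toFinset]
      refine Set.image_mono fun x hx => Or.inl ?_
      rcases hx with h | h
      · exact h.trans hrs
      · exact h.1.trans_lt hrs
    · intro r s hrs
      rw [Set.Finite.toFinset_subset_toFinset]
      rintro - ⟨i, rfl⟩
      exact ⟨(r, Flip.final, i), Or.inl hrs, rfl⟩
    · intro s
      exact (Set.ncard_eq_toFinset_card _ (Set.finite_range _)).symm.trans_le (hd s)
    · intro s ω ω' h
      rw [Set.Finite.coe_toFinset] at h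
      exact favoured_congr (agreeBefore_of_forall_mem h)
    · filter_upwards [hF] with ω hω s hs
      refine (stepsToDecide_le (decidesAt_of_coin_eq_favoured ht hC hω (s := s) fun i _ =>
        hs _ ((Set.Finite.mem_toFinset _).2 ⟨i, rfl⟩))).trans (le_of_eq ?_)
      push_cast
      ring
  refine ⟨?_, hm, hint⟩
  have hlt := ae_lt_top hm (hint.trans_lt (by simp [ENNReal.add_lt_top])).ne
  filter_upwards [hlt] with ω hω i hi
  obtain ⟨⟨S, hS⟩, -⟩ := iInf_lt_iff.1 hω
  obtain ⟨s, b, -, h⟩ := hS i hi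
  exact ⟨b, s, h⟩

end Liveness

end CasperBFT

theorem mainTheorem3 :
    ∃ C : ℝ≥0, ∀ (n : ℕ), 0 < n → ∀ (corrupt : Finset (Fin n)), corrupt.card ≤ (n - 1) / 3 →
      ∀ (input : Fin n → Bool) (adv : Adversary n),
        -- Safety, for all coin outcomes.
        (∀ (coin : ℕ → Flip → Fin n → Bool) (i j : Fin n) (b c : Bool),
          i ∉ corrupt → j ∉ corrupt →
          Decides ((n - 1) / 3) corrupt input adv coin i b →
          Decides ((n - 1) / 3) corrupt input adv coin j c → b = c) ∧
        (∀ (coin : ℕ → Flip → Fin n → Bool) (i j : Fin n) (b : Bool),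
          i ∉ corrupt → j ∉ corrupt →
          Fair ((n - 1) / 3) corrupt input adv coin →
          Decides ((n - 1) / 3) corrupt input adv coin i b →
          Decides ((n - 1) / 3) corrupt input adv coin j b) ∧
        -- Validity, for all coin outcomes.
        (∀ (coin : ℕ → Flip → Fin n → Bool) (b : Bool),
          (∀ i, i ∉ corrupt → input i = b) →
          ∀ (i : Fin n) (c : Bool), i ∉ corrupt →
            Decides ((n - 1) / 3) corrupt input adv coin i c → c = b) ∧
        -- Liveness with local coins.
        ((∀ᵐ ω ∂fairCoins (ℕ × Flip × Fin n),
            Fair ((n - 1) / 3) corrupt input adv (localCoin ω)) →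
          (∀ᵐ ω ∂fairCoins (ℕ × Flip × Fin n), ∀ i, i ∉ corrupt →
            ∃ b, Decides ((n - 1) / 3) corrupt input adv (localCoin ω) i b) ∧
          Measurable (fun ω : ℕ × Flip × Fin n → Bool =>
            stepsToDecide ((n - 1) / 3) corrupt input adv (localCoin ω)) ∧
          ∫⁻ ω, stepsToDecide ((n - 1) / 3) corrupt input adv (localCoin ω)
            ∂fairCoins (ℕ × Flip × Fin n) ≤ C * 2 ^ n) ∧
        -- Liveness with a common coin.
        ((∀ᵐ ω ∂fairCoins (ℕ × Flip),
            Fair ((n - 1) / 3) corrupt input adv (commonCoin ω)) →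
          (∀ᵐ ω ∂fairCoins (ℕ × Flip), ∀ i, i ∉ corrupt →
            ∃ b, Decides ((n - 1) / 3) corrupt input adv (commonCoin ω) i b) ∧
          Measurable (fun ω : ℕ × Flip → Bool =>
            stepsToDecide ((n - 1) / 3) corrupt input adv (commonCoin ω)) ∧
          ∫⁻ ω, stepsToDecide ((n - 1) / 3) corrupt input adv (commonCoin ω)
            ∂fairCoins (ℕ × Flip) ≤ C) := by
  refine ⟨3, fun n hn corrupt hC input adv => ?_⟩
  have ht : 3 * ((n - 1) / 3) < n := by omega
  refine ⟨fun coin i j b c hi hj hb hc => hb.agree ht hi hj hc,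
    fun coin i j b hi hj hF hb => hb.of_fair ht hC hF hi hj,
    fun coin b hin i c hi hc => hc.eq_input ht hC hin hi, fun hF => ?_, fun hF => ?_⟩
  · obtain ⟨h₁, h₂, h₃⟩ := liveness (d := n) ht hC (fun s f i => (s, f, i))
      (fun r f i r' f' i' h => by cases h; exact ⟨rfl, rfl⟩)
      (fun s => by
        rw [← Set.image_univ]
        exact (Set.ncard_image_le Set.finite_univ).trans (by simp [Set.ncard_univ])) hF
    refine ⟨h₁, h₂, h₃.trans ?_⟩
    calc (1 : ℝ≥0∞) + 2 ^ n ≤ 2 ^ n + 2 * 2 ^ n :=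
          add_le_add (one_le_pow₀ one_le_two) (le_mul_of_one_le_left' one_le_two)
      _ = ((3 : ℝ≥0) : ℝ≥0∞) * 2 ^ n := by push_cast; ring
  · obtain ⟨h₁, h₂, h₃⟩ := liveness (d := 1) ht hC (fun s f _ => (s, f))
      (fun r f i r' f' i' h => by cases h; exact ⟨rfl, rfl⟩)
      (fun s => (Set.ncard_le_ncard (t := {(s, Flip.final)})
        (by rintro - ⟨i, rfl⟩; rfl)).trans (Set.ncard_singleton _).le) hF
    refine ⟨h₁, h₂, h₃.trans (le_of_eq ?_)⟩
    push_cast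
    norm_num
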